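/- For $\gamma\in\mathbb R$, a positive sequence $(v_n)_{n\ge1}$ is said to be in $\mathcal{GS}(\gamma)$ if $\lim_{n\to\infty} n\,[1-v_{n-1}/v_n]=\gamma$. Let $(X_n,Y_n)_{n\ge 1}$ be i.i.d. pairs of real random variables with joint density $g(s,t)$. Put $f(s)=\int_{\mathbb R} g(s,t)\,dt$ (the density of $X$), $\mathbb E[Y^q|X=s]=f(s)^{-1}\int_{\mathbb R} t^q g(s,t)\,dt$, $r(s)=\mathbb E[Y|X=s]$ and $a(s)=r(s)f(s)$. Fix $x\in\mathbb R$ with $f(x)>0$. Let $K:\mathbb R\to\mathbb R$ be a kernel, $(\beta_n)_{n\ge1}$ and $(\gamma_n)_{n\ge1}$ stepsizes and $(h_n)_{n\ge1}$ a bandwidth, and assume: (A1) $K$ is continuous and bounded, $\int K(z)\,dz=1$, $\int zK(z)\,dz=0$, and $z\mapsto z^2K(z)$ is integrable. (A2) i) $(\beta_n)\in\mathcal{GS}(-\beta)$ with $\beta\in(1/2,1]$; ii) $(h_n)\in\mathcal{GS}(-a)$ with $a\in(0,1)$; iii) $\lim_{n\to\infty} n\beta_n$ exists in $\left(\min\{2a,(\beta-a)/2\},\infty\right]$.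 (A3) i) $s\mapsto g(s,t)$ is twice continuously differentiable for every $t$. ii) For $q\in\{0,1,2\}$, $s\mapsto\int t^q g(s,t)\,dt$ is a bounded function continuous at $s=x$; for $q\in[2,3]$, $s\mapsto\int|t|^q g(s,t)\,dt$ is a bounded function. iii) For $q\in\{0,1\}$, $\int|t|^q\left|\frac{\partial g}{\partial s}(x,t)\right|dt<\infty$, and $s\mapsto\int t^q\frac{\partial^2 g}{\partial s^2}(s,t)\,dt$ is a bounded function continuous at $s=x$. Moreover, the functions $f$ and $a$ are twice differentiable at $x$. Define $a_0(x)=f_0(x)=0$ and, for $n\ge1$, $$a_n(x)=(1-\beta_n)a_{n-1}(x)+\beta_nh_n^{-1}Y_nK\!\left(h_n^{-1}(x-X_n)\right),\qquad f_n(x)=(1-\gamma_n)f_{n-1}(x)+\gamma_nh_n^{-1}K\!\left(h_n^{-1}(x-X_n)\right),$$ and let $r_n(x)=a_n(x)/f_n(x)$ if $f_n(x)\ne0$ and $r_n(x)=0$ otherwise. Let $\xi=\lim_{n\to\infty}(n\beta_n)^{-1}$, $R(K)=\int K^2(z)\,dz$, $\mu_2(K)=\int z^2K(z)\,dz$, and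 $$B^{(2)}_{a,\xi}(x)=\frac1{2f(x)}\left(\frac{a^{(2)}(x)}{1-2a\xi}-\frac{1-a}{1-3a}\,r(x)f^{(2)}(x)\right)\mu_2(K),$$ $$V^{(2)}_{a,\xi,\beta}(x)=\left\{\frac{\mathbb E[Y^2|X=x]}{(2-(\beta-a)\xi)f(x)}-(1-a)\xi\,\frac{r^2(x)}{f(x)}\right\}R(K).$$ Suppose that $\gamma_n=(1-a)n^{-1}$ for all $n\ge1$. Then: 1. If $\beta_nh_n^{-1}\to0$ and there exists $c\ge0$ such that $\beta_n^{-1}h_n^5\to c$, then $V^{(2)}_{a,\xi,\beta}(x)\ge 0$ and $$\sqrt{\beta_n^{-1}h_n}\,\left(r_n(x)-r(x)\right)\ \xrightarrow{\ \mathcal D\ }\ \mathcal N\!\left(\sqrt c\,B^{(2)}_{a,\xi}(x),\,V^{(2)}_{a,\xi,\beta}(x)\right),$$ where the mean is $0$ when $c=0$. 2. If $\beta_n^{-1}h_n^5\to\infty$, then $$h_n^{-2}\left(r_n(x)-r(x)\right)\ \xrightarrow{\ \mathbb P\ }\ B^{(2)}_{a,\xi}(x).$$ -/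

import Mathlib

open MeasureTheory ProbabilityTheory Filter Topology

noncomputable section

namespace SemiRecursive

/-- The class `GS(γ)` of regularly varying sequences: `(v_n)_{n ≥ 1}` is positive and
`n * (1 - v_{n-1} / v_n) → γ`. The value `v 0` plays no role. -/
def GS (v : ℕ → ℝ) (γ : ℝ) : Prop :=
  (∀ n : ℕ, 1 ≤ n → 0 < v n) ∧
    Tendsto (fun n : ℕ => (n : ℝ) * (1 - v (n - 1) / v n)) atTop (𝓝 γ)

/-! ### The estimators

The stepsizes, the bandwidth and the sample are indexed by `n ≥ 1`; their values at `0` are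
never used. -/

/-- The recursive estimator `a_n(x)` of `a(x) = E(Y | X = x) f(x)`, with `a_0(x) = 0`. -/
def aEst {Ω : Type*} (K : ℝ → ℝ) (stepβ h : ℕ → ℝ) (X Y : ℕ → Ω → ℝ) (x : ℝ) : ℕ → Ω → ℝ
  | 0, _ => 0
  | n + 1, ω => (1 - stepβ (n + 1)) * aEst K stepβ h X Y x n ω +
      stepβ (n + 1) * (h (n + 1))⁻¹ * Y (n + 1) ω * K ((h (n + 1))⁻¹ * (x - X (n + 1) ω))

/-- The recursive estimator `f_n(x)` of the density `f(x)` of `X`, with `f_0(x) = 0`. -/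
def fEst {Ω : Type*} (K : ℝ → ℝ) (stepγ h : ℕ → ℝ) (X : ℕ → Ω → ℝ) (x : ℝ) : ℕ → Ω → ℝ
  | 0, _ => 0
  | n + 1, ω => (1 - stepγ (n + 1)) * fEst K stepγ h X x n ω +
      stepγ (n + 1) * (h (n + 1))⁻¹ * K ((h (n + 1))⁻¹ * (x - X (n + 1) ω))

open Classical in
/-- The semi-recursive estimator `r_n(x)` of the regression function. -/
def rEst {Ω : Type*} (K : ℝ → ℝ) (stepγ stepβ h : ℕ → ℝ) (X Y : ℕ → Ω → ℝ) (x : ℝ)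
    (n : ℕ) (ω : Ω) : ℝ :=
  if fEst K stepγ h X x n ω ≠ 0 then aEst K stepβ h X Y x n ω / fEst K stepγ h X x n ω else 0

/-! ### Quantities attached to the joint density `g` of `(X, Y)` and to the kernel -/

/-- The density `f` of `X`. -/
def marginal (g : ℝ → ℝ → ℝ) (s : ℝ) : ℝ := ∫ t, g s t

/-- `E[Y ^ q | X = s]`, computed from the joint density. -/
def condMoment (g : ℝ → ℝ → ℝ) (q : ℕ) (s : ℝ) : ℝ := (∫ t, t ^ q * g s t) / marginal g s

/-- The regression function `r(s) = E[Y | X = s]`. -/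
def regFun (g : ℝ → ℝ → ℝ) (s : ℝ) : ℝ := condMoment g 1 s

/-- The function `a(s) = E[Y | X = s] f(s)`. -/
def aFun (g : ℝ → ℝ → ℝ) (s : ℝ) : ℝ := regFun g s * marginal g s

/-- `φ` is twice differentiable at `x`. -/
def TwiceDifferentiableAt (φ : ℝ → ℝ) (x : ℝ) : Prop :=
  (∀ᶠ s in 𝓝 x, DifferentiableAt ℝ φ s) ∧ DifferentiableAt ℝ (deriv φ) x

/-- `R(K) = ∫ K²`. -/
def kernelR (K : ℝ → ℝ) : ℝ := ∫ z, K z ^ 2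

/-- `μ_j(K) = ∫ z ^ j K(z) dz`. -/
def kernelMoment (K : ℝ → ℝ) (j : ℕ) : ℝ := ∫ z, z ^ j * K z

/-- The asymptotic bias `B^{(2)}_{a,ξ}(x)`. -/
def biasB (K : ℝ → ℝ) (g : ℝ → ℝ → ℝ) (a ξ x : ℝ) : ℝ :=
  1 / (2 * marginal g x) *
    (deriv (deriv (aFun g)) x / (1 - 2 * a * ξ) -
      (1 - a) / (1 - 3 * a) * (regFun g x * deriv (deriv (marginal g)) x)) *
    kernelMoment K 2

/-- The asymptotic variance `V^{(2)}_{a,ξ,β}(x)`. -/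
def varV (K : ℝ → ℝ) (g : ℝ → ℝ → ℝ) (a ξ β x : ℝ) : ℝ :=
  (condMoment g 2 x / ((2 - (β - a) * ξ) * marginal g x) -
      (1 - a) * ξ * (regFun g x ^ 2 / marginal g x)) *
    kernelR K

/-! ### The assumptions -/

/-- The assumptions on the kernel. -/
structure KernelAssumption (K : ℝ → ℝ) : Prop where
  continuous : Continuous K
  bounded : ∃ M : ℝ, ∀ z, |K z| ≤ M
  integrable : Integrable K
  integral_eq_one : ∫ z, K z = 1
  integrable_one : Integrable (fun z => z * K z)
  integral_one : ∫ z, z * K z = 0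
  integrable_two : Integrable (fun z => z ^ 2 * K z)

/-- The assumptions on the stepsize `(β_n)` and on the bandwidth `(h_n)`. -/
structure StepAssumption (stepβ h : ℕ → ℝ) (β a : ℝ) : Prop where
  gs_step : GS stepβ (-β)
  β_mem : β ∈ Set.Ioc (1 / 2 : ℝ) 1
  gs_bandwidth : GS h (-a)
  a_mem : a ∈ Set.Ioo (0 : ℝ) 1
  lim_step : ∃ L : EReal, Tendsto (fun n : ℕ => (((n : ℝ) * stepβ n : ℝ) : EReal)) atTop (𝓝 L) ∧
    ((min (2 * a) ((β - a) / 2) : ℝ) : EReal) < L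

/-- The assumptions on the joint density `g` at the point `x`. Derivatives are with respect to
the first variable. -/
structure DensityAssumption (g : ℝ → ℝ → ℝ) (x : ℝ) : Prop where
  contDiff : ∀ t, ContDiff ℝ 2 (fun s => g s t)
  moment_integrable : ∀ q : ℕ, q ≤ 2 → ∀ s, Integrable (fun t => t ^ q * g s t)
  moment_bounded : ∀ q : ℕ, q ≤ 2 → ∃ M : ℝ, ∀ s, |∫ t, t ^ q * g s t| ≤ M
  moment_continuousAt : ∀ q : ℕ, q ≤ 2 → ContinuousAt (fun s => ∫ t, t ^ q * g s t) x
  abs_moment_integrable : ∀ q ∈ Set.Icc (2 : ℝ) 3, ∀ s, Integrable (fun t => |t| ^ q * g s t)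
  abs_moment_bounded : ∀ q ∈ Set.Icc (2 : ℝ) 3, ∃ M : ℝ, ∀ s, ∫ t, |t| ^ q * g s t ≤ M
  deriv_integrable : ∀ q : ℕ, q ≤ 1 →
    Integrable (fun t => |t| ^ q * |deriv (fun s => g s t) x|)
  deriv2_integrable : ∀ q : ℕ, q ≤ 1 → ∀ s,
    Integrable (fun t => t ^ q * deriv (deriv (fun u => g u t)) s)
  deriv2_bounded : ∀ q : ℕ, q ≤ 1 → ∃ M : ℝ, ∀ s,
    |∫ t, t ^ q * deriv (deriv (fun u => g u t)) s| ≤ M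
  deriv2_continuousAt : ∀ q : ℕ, q ≤ 1 →
    ContinuousAt (fun s => ∫ t, t ^ q * deriv (deriv (fun u => g u t)) s) x

/-- `(X_n, Y_n)`, `n ≥ 1`, are independent pairs, each with joint density `g`. -/
structure IsSample {Ω : Type*} [MeasurableSpace Ω] (P : Measure Ω) (X Y : ℕ → Ω → ℝ)
    (g : ℝ → ℝ → ℝ) : Prop where
  measurable_X : ∀ n, 1 ≤ n → Measurable (X n)
  measurable_Y : ∀ n, 1 ≤ n → Measurable (Y n)
  measurable_density : Measurable (Function.uncurry g)
  density_nonneg : ∀ s t, 0 ≤ g s t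
  indep : iIndepFun (fun (n : ℕ) (ω : Ω) => (X (n + 1) ω, Y (n + 1) ω)) P
  law : ∀ n, 1 ≤ n → P.map (fun ω => (X n ω, Y n ω)) =
    (volume : Measure (ℝ × ℝ)).withDensity (fun p => ENNReal.ofReal (g p.1 p.2))

end SemiRecursive

end

/-! Off the event `f_n(x) = 0`, `r_n(x) - r(x) = (a_n(x) - r(x) f_n(x)) / f_n(x)`. It therefore
suffices to find the limit law of the numerator, scaled by a sequence `m_n`, and to show `f_n(x) →
f(x)` in probability; Slutsky's lemma concludes. One result, `tendstoInDistribution_rEst`, serves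
both regimes: `m_n = √(β_n / h_n)` gives the central limit theorem, and `m_n = h_n²` gives a
Gaussian limit of variance zero, that is, convergence in probability.

Means, covariances and third-moment bounds of the two estimators all solve scalar recursions `u_n =
(1 - s_n c_n) u_{n-1} + s_n m_n e_n`. If `m ∈ GS(-μ)`, division by `m_n` leaves a recursion of the
same type with `c_n` replaced by a sequence tending to `c₀ - μ ξ`, so `u_n / m_n → e₀ / (c₀ - μ ξ)`
(`GS.tendsto_div_of_recursion`). This produces every denominator in the bias and the variance. The
limits `e₀` come from kernel smoothing: a second-order Taylor expansion for the bias, continuity at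
`x` for the second moments.

Normality is obtained from characteristic functions. At each step an independent centred innovation
is added, and its characteristic function differs from the Gaussian one of equal variance by at most
six third absolute moments. All factors have modulus at most one, so the errors add up along the
recursion (`CenteredRecursion.norm_charFun_sub_le`), and the total is `o(m_n³)` before rescaling.
Lévy's theorem then applies.

The stated constants follow from two facts: `(1 - β) ξ = 0`, and the sign of `β - 5a`, which is
fixed by the behaviour of `β_n⁻¹ h_n⁵` and decides which term attains the minimum in (A2). -/

namespace SemiRecursive

/-! ### Sequences defined by stochastic-approximation recursions -/

/-- A recursion `w_n = (1 - s_n d_n) w_{n-1} + s_n e_n` with `d_n → d₀ > 0`, `e_n → e₀` and steps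
`s_n → 0` bounded below by a multiple of `1 / n` converges to `e₀ / d₀`. -/
theorem tendsto_of_recursion {w s d e : ℕ → ℝ} {d₀ e₀ l : ℝ} (hl : 0 < l)
    (hsl : ∀ᶠ n : ℕ in atTop, l ≤ n * s n) (hs : Tendsto s atTop (𝓝 0))
    (hd : Tendsto d atTop (𝓝 d₀)) (hd₀ : 0 < d₀) (he : Tendsto e atTop (𝓝 e₀))
    (hrec : ∀ᶠ n : ℕ in atTop, w (n + 1) =
      (1 - s (n + 1) * d (n + 1)) * w n + s (n + 1) * e (n + 1)) :
    Tendsto w atTop (𝓝 (e₀ / d₀)) := by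
  rw [Metric.tendsto_atTop]
  intro ε₀ hε₀
  set ε := ε₀ / 2 with hε
  have hεpos : 0 < ε := by positivity
  have hsd : Tendsto (fun n => s n * d n) atTop (𝓝 0) := by simpa using hs.mul hd
  have hed : Tendsto (fun n => |e n - d n * (e₀ / d₀)|) atTop (𝓝 0) := by
    have := (he.sub (hd.mul_const (e₀ / d₀))).abs
    rwa [mul_div_cancel₀ _ hd₀.ne', sub_self, abs_zero] at this
  have h1 : ∀ᶠ n in atTop, s n * d n ≤ 1 := hsd.eventually_le_const one_pos
  have h2 : ∀ᶠ n in atTop, d₀ / 2 ≤ d n := hd.eventually_const_le (by linarith)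
  have h3 : ∀ᶠ n in atTop, |e n - d n * (e₀ / d₀)| ≤ ε * (d₀ / 2) :=
    hed.eventually_le_const (by positivity)
  obtain ⟨N, hN⟩ := eventually_atTop.1
    ((((h1.and h2).and h3).and hsl).and (hrec.and (eventually_ge_atTop 1)))
  have hspos : ∀ n, N ≤ n → 0 < s n := by
    intro n hn
    obtain ⟨⟨-, h4⟩, -, h6⟩ := hN n hn
    have : (0 : ℝ) < n := by exact_mod_cast h6
    by_contra hcon
    nlinarith [not_lt.1 hcon]
  -- The excess of the error over `ε` contracts by `1 - s_n d₀ / 2`, since the forcing error is at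
  -- most `ε d₀ / 2`. Its positive part thus decays like `exp (-(d₀ / 2) ∑ s_j)`, and `∑ s_j`
  -- diverges by comparison with the harmonic series.
  set z : ℕ → ℝ := fun n => |w n - e₀ / d₀| - ε with hz
  have hstep : ∀ n, N ≤ n → z (n + 1) ≤ (1 - s (n + 1) * (d₀ / 2)) * z n := by
    intro n hn
    obtain ⟨⟨⟨⟨a1, a2⟩, a3⟩, -⟩, -⟩ := hN (n + 1) (by omega)
    obtain ⟨-, a5, -⟩ := hN n hn
    have a6 := hspos (n + 1) (by omega)
    have : w (n + 1) - e₀ / d₀ = (1 - s (n + 1) * d (n + 1)) * (w n - e₀ / d₀) +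
        s (n + 1) * (e (n + 1) - d (n + 1) * (e₀ / d₀)) := by rw [a5]; ring
    have hb : |w (n + 1) - e₀ / d₀| ≤ (1 - s (n + 1) * d (n + 1)) * |w n - e₀ / d₀| +
        s (n + 1) * (ε * (d₀ / 2)) := by
      rw [this]
      refine (abs_add_le _ _).trans ?_
      rw [abs_mul, abs_mul, abs_of_nonneg (by linarith : 0 ≤ 1 - s (n + 1) * d (n + 1)),
        abs_of_pos a6]
      gcongr
    have hc : (1 - s (n + 1) * d (n + 1)) * |w n - e₀ / d₀| ≤
        (1 - s (n + 1) * (d₀ / 2)) * |w n - e₀ / d₀| := by gcongr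
    simp only [hz]
    nlinarith
  have hpos : ∀ k, max (z (N + k)) 0 ≤
      Real.exp (-(d₀ / 2) * ∑ j ∈ Finset.range k, s (j + (N + 1))) * max (z N) 0 := by
    intro k
    induction k with
    | zero => simp
    | succ k ih =>
      have a6 := hspos (N + k + 1) (by omega)
      obtain ⟨⟨⟨⟨a1, a2⟩, a3⟩, -⟩, -⟩ := hN (N + k + 1) (by omega)
      have a7 : s (N + k + 1) * (d₀ / 2) ≤ 1 := by nlinarith
      have a8 := hstep (N + k) (by omega)
      have hexp := Real.add_one_le_exp (-(d₀ / 2) * s (N + k + 1))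
      rw [Finset.sum_range_succ, mul_add, Real.exp_add, show k + (N + 1) = N + k + 1 by ring]
      refine max_le ?_ (by positivity)
      calc z (N + (k + 1)) ≤ (1 - s (N + k + 1) * (d₀ / 2)) * z (N + k) := a8
        _ ≤ (1 - s (N + k + 1) * (d₀ / 2)) * max (z (N + k)) 0 := by
            gcongr
            exact le_max_left _ _
        _ ≤ Real.exp (-(d₀ / 2) * s (N + k + 1)) * max (z (N + k)) 0 := by
            gcongr
            linarith
        _ ≤ Real.exp (-(d₀ / 2) * s (N + k + 1)) *
            (Real.exp (-(d₀ / 2) * ∑ j ∈ Finset.range k, s (j + (N + 1))) * max (z N) 0) := by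
            gcongr
        _ = _ := by ring
  have hns : ¬ Summable (fun j => s (j + (N + 1))) := by
    rw [summable_nat_add_iff (N + 1)]
    intro hsum
    have hsum' : Summable (fun n : ℕ => l * (1 / (n : ℝ))) := by
      refine hsum.of_norm_bounded_eventually_nat ?_
      filter_upwards [eventually_ge_atTop 1, hsl] with n hn hl'
      have : (0 : ℝ) < n := by exact_mod_cast hn
      rw [Real.norm_of_nonneg (by positivity), mul_one_div, div_le_iff₀ this]
      linarith
    exact Real.not_summable_one_div_natCast ((summable_mul_left_iff hl.ne').1 hsum')
  have hdiv : Tendsto (fun k => ∑ j ∈ Finset.range k, s (j + (N + 1))) atTop atTop :=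
    (not_summable_iff_tendsto_nat_atTop_of_nonneg
      (fun j => (hspos (j + (N + 1)) (by omega)).le)).1 hns
  have hlim : Tendsto (fun k => Real.exp (-(d₀ / 2) *
      ∑ j ∈ Finset.range k, s (j + (N + 1))) * max (z N) 0) atTop (𝓝 0) := by
    have := (Real.tendsto_exp_atBot.comp
      (hdiv.const_mul_atTop_of_neg (show -(d₀ / 2) < 0 by linarith))).mul_const (max (z N) 0)
    simpa using this
  obtain ⟨k₀, hk₀⟩ := eventually_atTop.1 (hlim.eventually_lt_const hεpos)
  refine ⟨N + k₀, fun n hn => ?_⟩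
  obtain ⟨k, rfl⟩ : ∃ k, n = N + k := ⟨n - N, by omega⟩
  have hfin := (le_max_left (z (N + k)) 0).trans_lt ((hpos k).trans_lt (hk₀ k (by omega)))
  simp only [hz] at hfin
  rw [Real.dist_eq]
  linarith

/-! ### The class `GS` -/

theorem GS.tendsto_ratio {v : ℕ → ℝ} {γ : ℝ} (hv : GS v γ) :
    Tendsto (fun n => v (n - 1) / v n) atTop (𝓝 1) := by
  have := (hv.2.mul tendsto_inv_atTop_nhds_zero_nat).const_sub 1
  rw [mul_zero, sub_zero] at this
  refine this.congr' ?_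
  filter_upwards [eventually_ge_atTop 1] with n hn
  have : (0 : ℝ) < n := by exact_mod_cast hn
  field_simp
  ring

theorem GS.mul {v w : ℕ → ℝ} {γ δ : ℝ} (hv : GS v γ) (hw : GS w δ) :
    GS (fun n => v n * w n) (γ + δ) := by
  refine ⟨fun n hn => mul_pos (hv.1 n hn) (hw.1 n hn), ?_⟩
  have := hv.2.add (hv.tendsto_ratio.mul hw.2)
  rw [one_mul] at this
  refine this.congr' ?_
  filter_upwards [eventually_ge_atTop 1] with n hn
  have := (hv.1 n hn).ne'
  have := (hw.1 n hn).ne'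
  field_simp
  ring

theorem GS.inv {v : ℕ → ℝ} {γ : ℝ} (hv : GS v γ) : GS (fun n => (v n)⁻¹) (-γ) := by
  refine ⟨fun n hn => inv_pos.2 (hv.1 n hn), ?_⟩
  have := hv.2.neg.mul (hv.tendsto_ratio.inv₀ one_ne_zero)
  rw [inv_one, mul_one] at this
  refine this.congr' ?_
  filter_upwards [eventually_ge_atTop 2] with n hn
  have := (hv.1 n (by omega)).ne'
  have := (hv.1 (n - 1) (by omega)).ne'
  field_simp
  ring

/-- With `ρ = v_{n-1} / v_n → 1`, use `1 - √ρ = (1 - ρ) / (1 + √ρ)`. -/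
theorem GS.sqrt {v : ℕ → ℝ} {γ : ℝ} (hv : GS v γ) : GS (fun n => √(v n)) (γ / 2) := by
  refine ⟨fun n hn => Real.sqrt_pos.2 (hv.1 n hn), ?_⟩
  have h1 : Tendsto (fun n => √(v (n - 1) / v n)) atTop (𝓝 1) := by
    simpa using hv.tendsto_ratio.sqrt
  have := hv.2.div (h1.const_add 1) (by norm_num)
  rw [one_add_one_eq_two] at this
  refine this.congr' ?_
  filter_upwards [eventually_ge_atTop 2] with n hn
  have h2 := hv.1 n (by omega)
  have h3 := hv.1 (n - 1) (by omega)
  have h4 : 0 < 1 + √(v (n - 1) / v n) := by positivity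
  rw [Pi.div_apply, div_eq_iff h4.ne', ← Real.sqrt_div h3.le]
  nlinarith [Real.sq_sqrt (div_pos h3 h2).le]

theorem GS.pow {v : ℕ → ℝ} {γ : ℝ} (hv : GS v γ) (k : ℕ) : GS (fun n => v n ^ k) (k * γ) := by
  induction k with
  | zero => exact ⟨fun n _ => by simp, by simp⟩
  | succ k ih =>
    have := ih.mul hv
    simp only [pow_succ, Nat.cast_succ, add_mul, one_mul]
    exact this

/-- The identity `v_n = (v_n / v_{n-1}) v_{n-1}` is itself an unforced recursion with step `1 / n`,
whose damping `n (1 - v_n / v_{n-1})` tends to `-γ > 0` because `v⁻¹ ∈ GS(-γ)`. -/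
theorem GS.tendsto_zero {v : ℕ → ℝ} {γ : ℝ} (hv : GS v γ) (hγ : γ < 0) :
    Tendsto v atTop (𝓝 0) := by
  have h := tendsto_of_recursion (w := v) (s := fun n : ℕ => (n : ℝ)⁻¹)
    (d := fun n => (n : ℝ) * (1 - (v (n - 1))⁻¹ / (v n)⁻¹)) (e := fun _ => 0) (d₀ := -γ) (e₀ := 0)
    (l := 1) one_pos ?_ tendsto_inv_atTop_nhds_zero_nat hv.inv.2 (by linarith)
    tendsto_const_nhds ?_
  · simpa using h
  · filter_upwards [eventually_ge_atTop 1] with n hn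
    have : (0 : ℝ) < n := by exact_mod_cast hn
    rw [mul_inv_cancel₀ this.ne']
  · filter_upwards [eventually_ge_atTop 1] with n hn
    have := (hv.1 n hn).ne'
    have := (hv.1 (n + 1) (by omega)).ne'
    have : (n : ℝ) + 1 ≠ 0 := by positivity
    simp only [Nat.add_sub_cancel, Nat.cast_add, Nat.cast_one]
    field_simp
    ring

theorem GS.tendsto_atTop {v : ℕ → ℝ} {γ : ℝ} (hv : GS v γ) (hγ : 0 < γ) :
    Tendsto v atTop atTop := by
  have h := hv.inv.tendsto_zero (by linarith)
  have h' : Tendsto (fun n => (v n)⁻¹) atTop (𝓝[>] 0) :=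
    tendsto_nhdsWithin_iff.2 ⟨h, by
      filter_upwards [eventually_ge_atTop 1] with n hn using inv_pos.2 (hv.1 n hn)⟩
  exact h'.inv_tendsto_nhdsGT_zero.congr fun n => inv_inv (v n)

/-- Averaging lemma for recursions whose forcing term is of the order of a sequence in `GS`. -/
theorem GS.tendsto_div_of_recursion {m s u c e : ℕ → ℝ} {μ ξ c₀ e₀ l : ℝ} (hm : GS m (-μ))
    (hl : 0 < l) (hsl : ∀ᶠ n : ℕ in atTop, l ≤ n * s n) (hs : Tendsto s atTop (𝓝 0))
    (hξ : Tendsto (fun n : ℕ => ((n : ℝ) * s n)⁻¹) atTop (𝓝 ξ))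
    (hc : Tendsto c atTop (𝓝 c₀)) (hμ : μ * ξ < c₀) (he : Tendsto e atTop (𝓝 e₀))
    (hrec : ∀ᶠ n : ℕ in atTop, u (n + 1) =
      (1 - s (n + 1) * c (n + 1)) * u n + s (n + 1) * m (n + 1) * e (n + 1)) :
    Tendsto (fun n => u n / m n) atTop (𝓝 (e₀ / (c₀ - μ * ξ))) := by
  set t : ℕ → ℝ := fun n => (n : ℝ) * (1 - m (n - 1) / m n) with ht
  have htl : Tendsto t atTop (𝓝 (-μ)) := hm.2
  -- With `m_{n-1} / m_n = 1 - t_n / n`, the damping `d_n` is read off from `(1 - s_n c_n)(1 - t_n /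
  -- n) = 1 - s_n d_n`.
  refine tendsto_of_recursion (s := s)
    (d := fun n => c n + t n * ((n : ℝ) * s n)⁻¹ - c n * (t n * (n : ℝ)⁻¹)) (e := e) hl hsl hs
    ?_ (by linarith) he ?_
  · have := (hc.add (htl.mul hξ)).sub (hc.mul (htl.mul tendsto_inv_atTop_nhds_zero_nat))
    convert this using 2
    ring
  · filter_upwards [hrec, eventually_ge_atTop 1, (tendsto_add_atTop_nat 1).eventually hsl]
      with n hn hn1 hn2
    have h1 := (hm.1 n hn1).ne'
    have h2 := (hm.1 (n + 1) (by omega)).ne'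
    have h3 : (((n + 1 : ℕ) : ℝ)) ≠ 0 := by positivity
    have h4 : s (n + 1) ≠ 0 := by
      intro h0
      rw [h0, mul_zero] at hn2
      linarith
    simp only [ht, Nat.add_sub_cancel]
    rw [hn]
    field_simp
    ring

/-! ### Characteristic functions: a third-moment bound -/

theorem norm_exp_mul_I_sub_taylor_le (x : ℝ) :
    ‖Complex.exp (x * Complex.I) - (1 + x * Complex.I - x ^ 2 / 2)‖ ≤ 5 * |x| ^ 3 := by
  rcases le_or_gt |x| 1 with hx | hx
  · have h := Complex.exp_bound (x := x * Complex.I) (n := 3) (by simpa using hx) (by norm_num)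
    have hsum : ∑ m ∈ Finset.range 3, ((x : ℂ) * Complex.I) ^ m / (m.factorial : ℂ) =
        1 + x * Complex.I - x ^ 2 / 2 := by
      simp [Finset.sum_range_succ, mul_pow, Nat.factorial]
      ring
    rw [hsum] at h
    refine h.trans ?_
    simp only [norm_mul, Complex.norm_real, Real.norm_eq_abs, Complex.norm_I, mul_one]
    norm_num [Nat.factorial]
    have : 0 ≤ |x| ^ 3 := by positivity
    linarith
  · have h1 : ‖Complex.exp (x * Complex.I)‖ = 1 := Complex.norm_exp_ofReal_mul_I x
    have h2 : ‖(1 : ℂ) + x * Complex.I - x ^ 2 / 2‖ ≤ 1 + |x| + |x| ^ 2 / 2 := by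
      refine (norm_sub_le _ _).trans (add_le_add ((norm_add_le _ _).trans ?_) ?_)
      · simp
      · simp
    refine (norm_sub_le _ _).trans ?_
    rw [h1]
    have h3 : |x| ≤ |x| ^ 2 := by nlinarith
    have h4 : |x| ^ 2 ≤ |x| ^ 3 := by nlinarith
    nlinarith

theorem abs_exp_neg_sub_le {σ : ℝ} (hσ : 0 ≤ σ) :
    |Real.exp (-(σ ^ 2) / 2) - (1 - σ ^ 2 / 2)| ≤ σ ^ 3 := by
  rcases le_or_gt σ 1 with h | h
  · have h1 := Real.abs_exp_sub_one_sub_id_le (x := -(σ ^ 2) / 2) (by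
      rw [abs_le]; constructor <;> nlinarith)
    rw [show Real.exp (-(σ ^ 2) / 2) - (1 - σ ^ 2 / 2) =
      Real.exp (-(σ ^ 2) / 2) - 1 - (-(σ ^ 2) / 2) by ring]
    refine h1.trans ?_
    have : σ ^ 4 ≤ σ ^ 3 := pow_le_pow_of_le_one hσ h (by norm_num)
    nlinarith
  · have h1 := Real.add_one_le_exp (-(σ ^ 2) / 2)
    have h2 : Real.exp (-(σ ^ 2) / 2) ≤ 1 := Real.exp_le_one_iff.2 (by nlinarith)
    have h3 : σ ^ 2 ≤ σ ^ 3 := pow_le_pow_right₀ h.le (by norm_num)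
    rw [abs_le]
    constructor <;> nlinarith

section

variable {Ω : Type*} [MeasurableSpace Ω] {P : Measure Ω} [IsProbabilityMeasure P]

theorem integrable_pow_of_memLp_three {Z : Ω → ℝ} (hZ : MemLp Z 3 P) {k : ℕ} (hk : k ≤ 3) :
    Integrable (fun ω => Z ω ^ k) P := by
  have h : MemLp Z k P := hZ.mono_exponent (by exact_mod_cast hk)
  have h2 := h.integrable_norm_pow'
  refine h2.mono (h.1.pow k) (by simp)

theorem integrable_abs_pow_three {Z : Ω → ℝ} (hZ : MemLp Z 3 P) :
    Integrable (fun ω => |Z ω| ^ 3) P := by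
  simpa using (integrable_pow_of_memLp_three hZ le_rfl).norm

/-- Jensen's inequality for `u ↦ u^{3/2}`, by integrating its tangent line at `u = σ²`; the
pointwise bound is `(2|z| + σ)(|z| - σ)² ≥ 0`. -/
theorem sqrt_second_moment_pow_le {Z : Ω → ℝ} (hZ : MemLp Z 3 P) :
    √(∫ ω, Z ω ^ 2 ∂P) ^ 3 ≤ ∫ ω, |Z ω| ^ 3 ∂P := by
  set σ := √(∫ ω, Z ω ^ 2 ∂P) with hσ
  have hσ0 : 0 ≤ σ := Real.sqrt_nonneg _
  have hσ2 : σ ^ 2 = ∫ ω, Z ω ^ 2 ∂P := Real.sq_sqrt (integral_nonneg fun _ => sq_nonneg _)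
  have hpt : ∀ ω, 3 / 2 * σ * Z ω ^ 2 - σ ^ 3 / 2 ≤ |Z ω| ^ 3 := by
    intro ω
    rw [← sq_abs]
    nlinarith [mul_nonneg (add_nonneg (mul_nonneg zero_le_two (abs_nonneg (Z ω))) hσ0)
      (sq_nonneg (|Z ω| - σ)), abs_nonneg (Z ω)]
  have hi : Integrable (fun ω => 3 / 2 * σ * Z ω ^ 2 - σ ^ 3 / 2) P :=
    ((integrable_pow_of_memLp_three hZ (by norm_num)).const_mul _).sub (integrable_const _)
  have := integral_mono hi (integrable_abs_pow_three hZ) hpt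
  rw [integral_sub ((integrable_pow_of_memLp_three hZ (by norm_num)).const_mul _)
    (integrable_const _), integral_const_mul, ← hσ2] at this
  simp only [integral_const, probReal_univ, one_smul] at this
  nlinarith

theorem integrable_exp_mul_I {Z : Ω → ℝ} (hZ : AEStronglyMeasurable Z P) :
    Integrable (fun ω => Complex.exp (Z ω * Complex.I)) P := by
  refine Integrable.of_bound (C := 1) ?_ (ae_of_all _ fun ω => ?_)
  · exact Complex.continuous_exp.comp_aestronglyMeasurable
      ((Complex.continuous_ofReal.comp_aestronglyMeasurable hZ).mul_const _)
  · rw [Complex.norm_exp_ofReal_mul_I]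

theorem norm_integral_exp_mul_I_le (Z : Ω → ℝ) :
    ‖∫ ω, Complex.exp (Z ω * Complex.I) ∂P‖ ≤ 1 := by
  refine (norm_integral_le_of_norm_le_const (C := 1) (ae_of_all _ fun ω => ?_)).trans ?_
  · rw [Complex.norm_exp_ofReal_mul_I]
  · simp

/-- Both terms are compared with `1 - σ² / 2`. The constant is `5 + 1`: Taylor's formula for the
characteristic function, and `σ³ ≤ E|Z|³` for the Gaussian. -/
theorem norm_integral_exp_mul_I_sub_le {Z : Ω → ℝ} (hZ : MemLp Z 3 P) (h0 : ∫ ω, Z ω ∂P = 0) :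
    ‖∫ ω, Complex.exp (Z ω * Complex.I) ∂P -
      (Real.exp (-(∫ ω, Z ω ^ 2 ∂P) / 2) : ℂ)‖ ≤ 6 * ∫ ω, |Z ω| ^ 3 ∂P := by
  have i1 : Integrable (fun ω => (Z ω : ℂ) * Complex.I) P :=
    (hZ.integrable (by norm_num)).ofReal.mul_const _
  have i2 : Integrable (fun ω => ((Z ω : ℂ) ^ 2) / 2) P := by
    have := (integrable_pow_of_memLp_three hZ (k := 2) (by norm_num)).ofReal (𝕜 := ℂ)
    simpa using this.div_const 2
  have i3 : Integrable (fun ω => (1 : ℂ) + Z ω * Complex.I - (Z ω : ℂ) ^ 2 / 2) P :=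
    ((integrable_const _).add i1).sub i2
  have e1 : ∫ ω, ((1 : ℂ) + Z ω * Complex.I - (Z ω : ℂ) ^ 2 / 2) ∂P =
      ((1 - (∫ ω, Z ω ^ 2 ∂P) / 2 : ℝ) : ℂ) := by
    have i0 : Integrable (fun ω => (1 : ℂ) + Z ω * Complex.I) P := (integrable_const _).add i1
    rw [integral_sub i0 i2, integral_add (integrable_const _) i1,
      integral_mul_const, integral_div, integral_complex_ofReal, h0]
    have : ∫ ω, (Z ω : ℂ) ^ 2 ∂P = ((∫ ω, Z ω ^ 2 ∂P : ℝ) : ℂ) := by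
      rw [← integral_complex_ofReal]
      simp
    rw [this]
    simp
  have b1 : ‖∫ ω, Complex.exp (Z ω * Complex.I) ∂P -
      ((1 - (∫ ω, Z ω ^ 2 ∂P) / 2 : ℝ) : ℂ)‖ ≤ 5 * ∫ ω, |Z ω| ^ 3 ∂P := by
    rw [← e1, ← integral_sub (integrable_exp_mul_I hZ.1) i3, ← integral_const_mul]
    exact norm_integral_le_of_norm_le ((integrable_abs_pow_three hZ).const_mul 5)
      (ae_of_all _ fun ω => norm_exp_mul_I_sub_taylor_le (Z ω))
  have b2 : ‖((1 - (∫ ω, Z ω ^ 2 ∂P) / 2 : ℝ) : ℂ) -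
      (Real.exp (-(∫ ω, Z ω ^ 2 ∂P) / 2) : ℂ)‖ ≤ ∫ ω, |Z ω| ^ 3 ∂P := by
    rw [← Complex.ofReal_sub, Complex.norm_real, Real.norm_eq_abs, abs_sub_comm]
    refine le_trans ?_ (sqrt_second_moment_pow_le hZ)
    have := abs_exp_neg_sub_le (Real.sqrt_nonneg (∫ ω, Z ω ^ 2 ∂P))
    rwa [Real.sq_sqrt (integral_nonneg fun _ => sq_nonneg _)] at this
  calc _ ≤ _ + _ := norm_sub_le_norm_sub_add_norm_sub _ ((1 - (∫ ω, Z ω ^ 2 ∂P) / 2 : ℝ) : ℂ) _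
    _ ≤ _ := add_le_add b1 b2
    _ = _ := by ring

/-! ### Gaussian approximation of a pair of centred recursive averages -/

/-- The solution of `u_n = q_n u_{n-1} + f_n`, `u_0 = 0`. -/
def recSeq (q f : ℕ → ℝ) : ℕ → ℝ
  | 0 => 0
  | n + 1 => q (n + 1) * recSeq q f n + f (n + 1)

/-- A pair of recursive averages `A_n = (1 - p_n) A_{n-1} + p_n U_n`,
`F_n = (1 - q_n) F_{n-1} + q_n W_n` of centred innovations, `(U_n, W_n)` being independent of
the past. -/
structure CenteredRecursion (P : Measure Ω) (p q : ℕ → ℝ) (A F U W : ℕ → Ω → ℝ) : Prop where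
  zero_fst : ∀ ω, A 0 ω = 0
  zero_snd : ∀ ω, F 0 ω = 0
  succ_fst : ∀ n ω, A (n + 1) ω = (1 - p (n + 1)) * A n ω + p (n + 1) * U (n + 1) ω
  succ_snd : ∀ n ω, F (n + 1) ω = (1 - q (n + 1)) * F n ω + q (n + 1) * W (n + 1) ω
  measurable_fst : ∀ n, Measurable (A n)
  measurable_snd : ∀ n, Measurable (F n)
  memLp_fst : ∀ n, MemLp (U (n + 1)) 3 P
  memLp_snd : ∀ n, MemLp (W (n + 1)) 3 P
  integral_fst : ∀ n, ∫ ω, U (n + 1) ω ∂P = 0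
  integral_snd : ∀ n, ∫ ω, W (n + 1) ω ∂P = 0
  indep : ∀ n, IndepFun (fun ω => (A n ω, F n ω)) (fun ω => (U (n + 1) ω, W (n + 1) ω)) P

/-- The covariance recursion of two recursive averages with steps `p` and `q`. -/
noncomputable def covSeq (P : Measure Ω) (p q : ℕ → ℝ) (U W : ℕ → Ω → ℝ) : ℕ → ℝ :=
  recSeq (fun n => (1 - p n) * (1 - q n)) (fun n => p n * q n * ∫ ω, U n ω * W n ω ∂P)

/-- A recursive bound on the third moments of a recursive average with steps `p`. -/
noncomputable def thirdSeq (P : Measure Ω) (p : ℕ → ℝ) (U : ℕ → Ω → ℝ) : ℕ → ℝ :=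
  recSeq (fun n => |1 - p n| ^ 3) (fun n => |p n| ^ 3 * ∫ ω, |U n ω| ^ 3 ∂P)

/-- The variance of `s A_n + t F_n`. -/
noncomputable def varForm (P : Measure Ω) (p q : ℕ → ℝ) (U W : ℕ → Ω → ℝ) (n : ℕ) (s t : ℝ) : ℝ :=
  s ^ 2 * covSeq P p p U U n + 2 * s * t * covSeq P p q U W n + t ^ 2 * covSeq P q q W W n

theorem abs_add_pow_three_le (x y : ℝ) : |x + y| ^ 3 ≤ 4 * (|x| ^ 3 + |y| ^ 3) := by
  have h1 := abs_add_le x y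
  have h2 : |x + y| ^ 3 ≤ (|x| + |y|) ^ 3 := by gcongr
  nlinarith [mul_nonneg (add_nonneg (abs_nonneg x) (abs_nonneg y)) (sq_nonneg (|x| - |y|))]

namespace CenteredRecursion

variable {p q : ℕ → ℝ} {A F U W : ℕ → Ω → ℝ}

theorem varForm_succ (H : CenteredRecursion P p q A F U W) (n : ℕ) (s t : ℝ) :
    varForm P p q U W (n + 1) s t =
      varForm P p q U W n (s * (1 - p (n + 1))) (t * (1 - q (n + 1))) +
      ∫ ω, (s * p (n + 1) * U (n + 1) ω + t * q (n + 1) * W (n + 1) ω) ^ 2 ∂P := by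
  have hU := (H.memLp_fst n).mono_exponent (p := 2) (by norm_num)
  have hW := (H.memLp_snd n).mono_exponent (p := 2) (by norm_num)
  have e : ∀ ω, (s * p (n + 1) * U (n + 1) ω + t * q (n + 1) * W (n + 1) ω) ^ 2 =
      (s * p (n + 1)) ^ 2 * (U (n + 1) ω * U (n + 1) ω) +
      2 * (s * p (n + 1)) * (t * q (n + 1)) * (U (n + 1) ω * W (n + 1) ω) +
      (t * q (n + 1)) ^ 2 * (W (n + 1) ω * W (n + 1) ω) := fun ω => by ring
  have i1 : Integrable (fun ω => (s * p (n + 1)) ^ 2 * (U (n + 1) ω * U (n + 1) ω)) P :=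
    (hU.integrable_mul hU).const_mul _
  have i2 : Integrable (fun ω => 2 * (s * p (n + 1)) * (t * q (n + 1)) *
      (U (n + 1) ω * W (n + 1) ω)) P := (hU.integrable_mul hW).const_mul _
  have i3 : Integrable (fun ω => (t * q (n + 1)) ^ 2 * (W (n + 1) ω * W (n + 1) ω)) P :=
    (hW.integrable_mul hW).const_mul _
  simp_rw [e]
  rw [integral_add (f := fun ω => _ + _) (i1.add i2) i3, integral_add i1 i2, integral_const_mul, integral_const_mul,
    integral_const_mul]
  simp only [varForm, covSeq, recSeq]
  ring

/-- Nonnegativity passes to the limit, which is how the asymptotic variance is seen to be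
nonnegative. -/
theorem varForm_nonneg (H : CenteredRecursion P p q A F U W) (n : ℕ) :
    ∀ s t : ℝ, 0 ≤ varForm P p q U W n s t := by
  induction n with
  | zero => intro s t; simp [varForm, covSeq, recSeq]
  | succ n ih =>
    intro s t
    rw [H.varForm_succ]
    exact add_nonneg (ih _ _) (integral_nonneg fun _ => sq_nonneg _)

/-- Replacing the innovations by Gaussians one at a time costs a third moment each. The
quantification over all `s, t` is needed by the induction, which moves to `s (1 - p)`, `t (1 - q)`;
it also allows weights depending on `n` later. The constant is `6 * 4`, where `4` comes from
splitting `|x + y|³`. -/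
theorem norm_charFun_sub_le (H : CenteredRecursion P p q A F U W) (n : ℕ) :
    ∀ s t : ℝ, ‖∫ ω, Complex.exp (((s * A n ω + t * F n ω : ℝ) : ℂ) * Complex.I) ∂P -
      (Real.exp (-(varForm P p q U W n s t) / 2) : ℂ)‖ ≤
      24 * (|s| ^ 3 * thirdSeq P p U n + |t| ^ 3 * thirdSeq P q W n) := by
  induction n with
  | zero => intro s t; simp [varForm, covSeq, thirdSeq, recSeq, H.zero_fst, H.zero_snd]
  | succ n ih =>
    intro s t
    set p' := p (n + 1) with hp'
    set q' := q (n + 1) with hq'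
    set Z : Ω → ℝ := fun ω => s * p' * U (n + 1) ω + t * q' * W (n + 1) ω with hZ
    set V : Ω → ℝ := fun ω => s * (1 - p') * A n ω + t * (1 - q') * F n ω with hV
    have mU := H.memLp_fst n
    have mW := H.memLp_snd n
    have mZ : MemLp Z 3 P := (mU.const_mul _).add (mW.const_mul _)
    have mV : AEStronglyMeasurable V P :=
      (((H.measurable_fst n).const_mul _).add ((H.measurable_snd n).const_mul _)).aestronglyMeasurable
    have hZ0 : ∫ ω, Z ω ∂P = 0 := by
      rw [integral_add ((mU.integrable (by norm_num)).const_mul _)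
        ((mW.integrable (by norm_num)).const_mul _), integral_const_mul, integral_const_mul,
        H.integral_fst, H.integral_snd]
      simp
    have hind : IndepFun (fun ω => Complex.exp (V ω * Complex.I))
        (fun ω => Complex.exp (Z ω * Complex.I)) P := by
      have h1 : Measurable fun v : ℝ × ℝ =>
          Complex.exp (((s * (1 - p') * v.1 + t * (1 - q') * v.2 : ℝ) : ℂ) * Complex.I) := by
        fun_prop
      have h2 : Measurable fun v : ℝ × ℝ =>
          Complex.exp (((s * p' * v.1 + t * q' * v.2 : ℝ) : ℂ) * Complex.I) := by
        fun_prop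
      exact (H.indep n).comp h1 h2
    have hprod : ∫ ω, Complex.exp (((s * A (n + 1) ω + t * F (n + 1) ω : ℝ) : ℂ) * Complex.I) ∂P =
        (∫ ω, Complex.exp (V ω * Complex.I) ∂P) * ∫ ω, Complex.exp (Z ω * Complex.I) ∂P := by
      rw [← hind.integral_fun_mul_eq_mul_integral (integrable_exp_mul_I mV).1
        (integrable_exp_mul_I mZ.1).1]
      congr 1
      ext ω
      rw [← Complex.exp_add, ← add_mul, ← Complex.ofReal_add, H.succ_fst, H.succ_snd]
      congr 3
      simp only [hV, hZ]
      ring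
    have hexp : (Real.exp (-(varForm P p q U W (n + 1) s t) / 2) : ℂ) =
        (Real.exp (-(varForm P p q U W n (s * (1 - p')) (t * (1 - q'))) / 2) : ℂ) *
        (Real.exp (-(∫ ω, Z ω ^ 2 ∂P) / 2) : ℂ) := by
      rw [H.varForm_succ, ← Complex.ofReal_mul, ← Real.exp_add]
      congr 2
      simp only [hZ]
      ring
    have b1 := ih (s * (1 - p')) (t * (1 - q'))
    have b2 := norm_integral_exp_mul_I_sub_le mZ hZ0
    have b3 : ‖(Real.exp (-(∫ ω, Z ω ^ 2 ∂P) / 2) : ℂ)‖ ≤ 1 := by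
      rw [Complex.norm_real, Real.norm_eq_abs, Real.abs_exp]
      refine Real.exp_le_one_iff.2 ?_
      have : 0 ≤ ∫ ω, Z ω ^ 2 ∂P := integral_nonneg fun _ => sq_nonneg _
      linarith
    have b4 : ∫ ω, |Z ω| ^ 3 ∂P ≤ 4 * (|s * p'| ^ 3 * ∫ ω, |U (n + 1) ω| ^ 3 ∂P +
        |t * q'| ^ 3 * ∫ ω, |W (n + 1) ω| ^ 3 ∂P) := by
      have iU := (integrable_abs_pow_three mU).const_mul (|s * p'| ^ 3)
      have iW := (integrable_abs_pow_three mW).const_mul (|t * q'| ^ 3)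
      rw [← integral_const_mul, ← integral_const_mul, ← integral_add iU iW, ← integral_const_mul]
      refine integral_mono (integrable_abs_pow_three mZ) ((iU.add iW).const_mul 4) fun ω => ?_
      have := abs_add_pow_three_le (s * p' * U (n + 1) ω) (t * q' * W (n + 1) ω)
      rwa [abs_mul (s * p'), abs_mul (t * q'), mul_pow, mul_pow] at this
    rw [hprod, hexp]
    set φ := ∫ ω, Complex.exp (V ω * Complex.I) ∂P
    set ψ := ∫ ω, Complex.exp (Z ω * Complex.I) ∂P
    set e₁ : ℂ := (Real.exp (-(varForm P p q U W n (s * (1 - p')) (t * (1 - q'))) / 2) : ℂ)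
    set e₂ : ℂ := (Real.exp (-(∫ ω, Z ω ^ 2 ∂P) / 2) : ℂ)
    have b0 : ‖φ‖ ≤ 1 := norm_integral_exp_mul_I_le V
    -- As `φ` and `e₂` have modulus at most one, the old and new errors simply add.
    calc ‖φ * ψ - e₁ * e₂‖ = ‖φ * (ψ - e₂) + (φ - e₁) * e₂‖ := by congr 1; ring
      _ ≤ ‖φ‖ * ‖ψ - e₂‖ + ‖φ - e₁‖ * ‖e₂‖ := by
          refine (norm_add_le _ _).trans ?_
          rw [norm_mul, norm_mul]
      _ ≤ 1 * ‖ψ - e₂‖ + ‖φ - e₁‖ * 1 := by gcongr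
      _ ≤ 6 * (4 * (|s * p'| ^ 3 * ∫ ω, |U (n + 1) ω| ^ 3 ∂P +
        |t * q'| ^ 3 * ∫ ω, |W (n + 1) ω| ^ 3 ∂P)) + 24 * (|s * (1 - p')| ^ 3 * thirdSeq P p U n +
          |t * (1 - q')| ^ 3 * thirdSeq P q W n) := by
          linarith
      _ = _ := by
          simp only [thirdSeq, recSeq, abs_mul, mul_pow]
          ring

end CenteredRecursion

/-! ### Convergence in distribution and in probability -/

theorem tendstoInDistribution_gaussianReal {Z : ℕ → Ω → ℝ} (hZ : ∀ n, AEMeasurable (Z n) P)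
    {μ v : ℝ} (hv : 0 ≤ v)
    (h : ∀ τ : ℝ, Tendsto (fun n => ∫ ω, Complex.exp (((τ * Z n ω : ℝ) : ℂ) * Complex.I) ∂P) atTop
      (𝓝 (Complex.exp (((τ * μ : ℝ) : ℂ) * Complex.I) * (Real.exp (-(τ ^ 2 * v) / 2) : ℂ)))) :
    TendstoInDistribution Z atTop (id : ℝ → ℝ) (fun _ => P) (gaussianReal μ v.toNNReal) where
  forall_aemeasurable := hZ
  aemeasurable_limit := aemeasurable_id
  tendsto := by
    refine ProbabilityMeasure.tendsto_iff_tendsto_charFun.2 fun τ => ?_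
    simp only [ProbabilityMeasure.coe_mk, Measure.map_id]
    rw [charFun_gaussianReal]
    convert h τ using 1
    · ext n
      rw [charFun_apply_real, integral_map (hZ n) (by fun_prop)]
      simp
    · rw [Complex.ofReal_exp, ← Complex.exp_add]
      congr 2
      push_cast
      rw [Real.coe_toNNReal v hv]
      ring

/-- A Gaussian of variance zero is a Dirac mass, and the frontier of `{ε ≤ |z - μ|}` does not
contain `μ`, so the portmanteau theorem applies. -/
theorem tendstoInMeasure_of_tendstoInDistribution_const {Z : ℕ → Ω → ℝ} {μ : ℝ}
    (h : TendstoInDistribution Z atTop (id : ℝ → ℝ) (fun _ => P) (gaussianReal μ 0)) :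
    TendstoInMeasure P Z atTop (fun _ => μ) := by
  rw [tendstoInMeasure_iff_norm]
  intro ε hε
  have hcl : IsClosed {z : ℝ | ε ≤ ‖z - μ‖} :=
    isClosed_le continuous_const (continuous_id.sub continuous_const).norm
  have h1 := ProbabilityMeasure.tendsto_measure_of_null_frontier_of_tendsto' h.tendsto
    (E := {z : ℝ | ε ≤ ‖z - μ‖}) ?_
  · have h2 : (gaussianReal μ 0) {z : ℝ | ε ≤ ‖z - μ‖} = 0 := by
      rw [gaussianReal_zero_var, Measure.dirac_apply' _ hcl.measurableSet]
      simp [hε]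
    simp only [ProbabilityMeasure.coe_mk, Measure.map_id, h2] at h1
    refine h1.congr fun n => ?_
    rw [Measure.map_apply_of_aemeasurable (h.forall_aemeasurable n) hcl.measurableSet]
    rfl
  · simp only [ProbabilityMeasure.coe_mk, Measure.map_id]
    refine measure_mono_null hcl.frontier_subset ?_
    rw [gaussianReal_zero_var, Measure.dirac_apply' _ hcl.measurableSet]
    simp [hε]

theorem TendstoInMeasure.comp_continuousAt {Ω : Type*} [MeasurableSpace Ω] {P : Measure Ω}
    {Z : ℕ → Ω → ℝ} {c : ℝ} {φ : ℝ → ℝ}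
    (h : TendstoInMeasure P Z atTop (fun _ => c)) (hφ : ContinuousAt φ c) :
    TendstoInMeasure P (fun n ω => φ (Z n ω)) atTop (fun _ => φ c) := by
  rw [tendstoInMeasure_iff_dist] at h ⊢
  intro ε hε
  obtain ⟨δ, hδ, hδ'⟩ := Metric.continuousAt_iff.1 hφ ε hε
  refine tendsto_of_tendsto_of_tendsto_of_le_of_le tendsto_const_nhds (h δ hδ)
    (fun n => zero_le) fun n => measure_mono fun ω hω => ?_
  simp only [Set.mem_ofPred_eq] at hω ⊢
  by_contra hcon
  exact absurd (hδ' (not_le.1 hcon)) (not_lt.2 hω)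

/-- A ratio of estimators: if `(a_n - r f_n) / m_n` is asymptotically normal and `f_n` converges in
probability to `f > 0`, then `(a_n / f_n - r) / m_n` is asymptotically normal. -/
theorem tendstoInDistribution_ratio {aN fN : ℕ → Ω → ℝ} (ha : ∀ n, AEMeasurable (aN n) P)
    (hf : ∀ n, AEMeasurable (fN n) P) {m : ℕ → ℝ} {r f μ v : ℝ} (hf0 : 0 < f)
    (hlim : TendstoInDistribution (fun n ω => (m n)⁻¹ * (aN n ω - r * fN n ω)) atTop
      (id : ℝ → ℝ) (fun _ => P) (gaussianReal μ v.toNNReal))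
    (hfN : TendstoInMeasure P fN atTop (fun _ => f)) :
    TendstoInDistribution (fun n ω => (m n)⁻¹ * (aN n ω / fN n ω - r)) atTop
      (id : ℝ → ℝ) (fun _ => P) (gaussianReal (μ / f) (v / f ^ 2).toNNReal) := by
  have hinv := TendstoInMeasure.comp_continuousAt hfN (continuousAt_inv₀ hf0.ne')
  have h1 := hlim.continuous_comp_prodMk_of_tendstoInMeasure_const
    (g := fun z : ℝ × ℝ => z.1 * z.2) (by fun_prop) hinv (fun n => (hf n).inv)
  have h2 : TendstoInDistribution (fun n ω => (m n)⁻¹ * (aN n ω / fN n ω - r)) atTop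
      (fun z : ℝ => id z * f⁻¹) (fun _ => P) (gaussianReal μ v.toNNReal) := by
    refine tendstoInDistribution_of_tendstoInMeasure_sub _ _ h1 ?_
      (fun n => (((ha n).div (hf n)).sub_const r).const_mul _)
    rw [tendstoInMeasure_iff_norm] at hfN ⊢
    intro ε hε
    -- The two expressions differ only where `f_n = 0`, and there `|f_n - f| = f`; hence the radius
    -- `f`.
    refine tendsto_of_tendsto_of_tendsto_of_le_of_le tendsto_const_nhds (hfN f hf0)
      (fun n => zero_le) fun n => measure_mono fun ω hω => ?_
    simp only [Set.mem_ofPred_eq, Pi.sub_apply, Pi.zero_apply, sub_zero] at hω ⊢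
    have h0 : fN n ω = 0 := by
      by_contra hne
      have : (m n)⁻¹ * (aN n ω / fN n ω - r) -
          (m n)⁻¹ * (aN n ω - r * fN n ω) * (fN n ω)⁻¹ = 0 := by
        field_simp
        ring
      rw [this, norm_zero] at hω
      linarith
    rw [h0, zero_sub, norm_neg, Real.norm_of_nonneg hf0.le]
  have h3 : (gaussianReal μ v.toNNReal).map (fun z : ℝ => id z * f⁻¹) =
      gaussianReal (μ / f) (v / f ^ 2).toNNReal := by
    have := gaussianReal_map_mul_const (μ := μ) (v := v.toNNReal) f⁻¹
    simp only [id]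
    rw [this, div_eq_inv_mul]
    congr 1
    rw [div_eq_inv_mul, Real.toNNReal_mul (by positivity)]
    congr 1
    ext
    simp [sq_nonneg]
  refine ⟨h2.forall_aemeasurable, aemeasurable_id, ?_⟩
  convert h2.tendsto using 2
  ext1
  simp only [Measure.map_id, h3]

end

/-! ### Kernel smoothing of a bounded function -/

/-- Peano's form of Taylor's formula. One use of L'Hôpital's rule leaves the difference quotient of
`deriv G` at `x`, so no continuity of the second derivative is required. -/
theorem TwiceDifferentiableAt.tendsto_taylor {G : ℝ → ℝ} {x : ℝ} (hG : TwiceDifferentiableAt G x) :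
    Tendsto (fun y => (G (x + y) - G x - deriv G x * y) / y ^ 2) (𝓝[≠] 0)
      (𝓝 (deriv (deriv G) x / 2)) := by
  have hx : Tendsto (fun y : ℝ => x + y) (𝓝 0) (𝓝 x) := by
    have : Continuous fun y : ℝ => x + y := by fun_prop
    simpa using this.tendsto 0
  have hd : ∀ᶠ y in 𝓝 (0 : ℝ), HasDerivAt (fun y => G (x + y) - G x - deriv G x * y)
      (deriv G (x + y) - deriv G x) y := by
    filter_upwards [hx.eventually hG.1] with y hy
    have h1 : HasDerivAt (fun y => G (x + y)) (deriv G (x + y)) y := hy.hasDerivAt.comp_const_add x y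
    have h2 := (h1.sub_const (G x)).sub ((hasDerivAt_id y).const_mul (deriv G x))
    rw [mul_one] at h2
    exact h2
  refine HasDerivAt.lhopital_zero_nhdsNE (f' := fun y => deriv G (x + y) - deriv G x)
    (g' := fun y => 2 * y) (hd.filter_mono nhdsWithin_le_nhds) ?_ ?_ ?_ ?_ ?_
  · exact Eventually.of_forall fun y => by simpa using hasDerivAt_pow 2 y
  · filter_upwards [self_mem_nhdsWithin] with y hy
    exact mul_ne_zero two_ne_zero hy
  · have := hd.self_of_nhds.continuousAt.tendsto
    simp only [add_zero, sub_self, mul_zero] at this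
    exact this.mono_left nhdsWithin_le_nhds
  · have : Continuous fun y : ℝ => y ^ 2 := by fun_prop
    have := this.tendsto 0
    rw [zero_pow two_ne_zero] at this
    exact this.mono_left nhdsWithin_le_nhds
  · have h1 := (hasDerivAt_iff_tendsto_slope_zero.1 hG.2.hasDerivAt).div_const 2
    refine h1.congr' ?_
    filter_upwards [self_mem_nhdsWithin] with y hy
    have : y ≠ 0 := hy
    rw [smul_eq_mul]
    field_simp

/-- Supplies the dominating constant for the bias: convergence controls small `y`, boundedness of
`G` large `y`. -/
theorem TwiceDifferentiableAt.exists_taylor_bound {G : ℝ → ℝ} {x M : ℝ}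
    (hG : TwiceDifferentiableAt G x) (hM : ∀ s, |G s| ≤ M) :
    ∃ C, ∀ y, |(G (x + y) - G x - deriv G x * y) / y ^ 2| ≤ C := by
  have h1 := hG.tendsto_taylor.abs.eventually_le_const
    (lt_add_one |deriv (deriv G) x / 2|)
  rw [eventually_nhdsWithin_iff, Metric.eventually_nhds_iff] at h1
  obtain ⟨δ, hδ, h1⟩ := h1
  have hM0 : 0 ≤ M := (abs_nonneg _).trans (hM x)
  refine ⟨|deriv (deriv G) x / 2| + 1 + (2 * M / δ ^ 2 + |deriv G x| / δ), fun y => ?_⟩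
  have n1 : 0 ≤ 2 * M / δ ^ 2 + |deriv G x| / δ := by positivity
  have n2 : 0 ≤ |deriv (deriv G) x / 2| := abs_nonneg _
  rcases eq_or_ne y 0 with rfl | hy
  · simp only [ne_eq, OfNat.ofNat_ne_zero, not_false_eq_true, zero_pow, div_zero, abs_zero]
    linarith
  rcases lt_or_ge |y| δ with h | h
  · have := h1 (by simpa using h) hy
    linarith
  · have hy0 : 0 < |y| := abs_pos.2 hy
    have h2 : |G (x + y) - G x - deriv G x * y| ≤ 2 * M + |deriv G x| * |y| := by
      rw [← abs_mul]
      refine (abs_sub _ _).trans (add_le_add_left ((abs_sub _ _).trans ?_) _)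
      linarith [hM (x + y), hM x]
    rw [abs_div, abs_pow]
    calc _ ≤ (2 * M + |deriv G x| * |y|) / |y| ^ 2 := by gcongr
      _ = 2 * M / |y| ^ 2 + |deriv G x| / |y| := by field_simp
      _ ≤ 2 * M / δ ^ 2 + |deriv G x| / δ := by gcongr
      _ ≤ _ := by linarith

theorem integrable_mul_comp_sub {k G : ℝ → ℝ} (hk : Integrable k) (hG : Measurable G) {M : ℝ}
    (hM : ∀ s, |G s| ≤ M) (x h : ℝ) : Integrable fun z => k z * G (x - h * z) := by
  refine hk.mul_bdd (c := M) ?_ (ae_of_all _ fun z => by simpa using hM _)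
  exact (hG.comp (by fun_prop)).aestronglyMeasurable

theorem tendsto_integral_kernel {k G : ℝ → ℝ} (hk : Integrable k) (hG : Measurable G) {M x : ℝ}
    (hM : ∀ s, |G s| ≤ M) (hx : ContinuousAt G x) :
    Tendsto (fun h => ∫ z, k z * G (x - h * z)) (𝓝[>] 0) (𝓝 (G x * ∫ z, k z)) := by
  rw [← integral_const_mul]
  refine tendsto_integral_filter_of_dominated_convergence (fun z => ‖k z‖ * M)
    (Eventually.of_forall fun h => (integrable_mul_comp_sub hk hG hM x h).1)
    (Eventually.of_forall fun h => ae_of_all _ fun z => ?_) (hk.norm.mul_const M)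
    (ae_of_all _ fun z => ?_)
  · rw [norm_mul]
    gcongr
    exact hM _
  · have h1 : Tendsto (fun h => x - h * z) (𝓝[>] 0) (𝓝 x) := by
      have : Continuous fun h : ℝ => x - h * z := by fun_prop
      have := this.tendsto 0
      rw [zero_mul, sub_zero] at this
      exact this.mono_left nhdsWithin_le_nhds
    rw [mul_comm]
    exact (hx.tendsto.comp h1).const_mul _

/-- Since `∫ K = 1` and `∫ z K = 0`, the scaled bias is exactly `∫ z² K(z) R(-hz) dz`, with `R` the
Taylor quotient; dominated convergence gives the limit. -/
theorem KernelAssumption.tendsto_bias {K G : ℝ → ℝ} (hK : KernelAssumption K) (hG : Measurable G)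
    {M x : ℝ} (hM : ∀ s, |G s| ≤ M) (hx : TwiceDifferentiableAt G x) :
    Tendsto (fun h => (h ^ 2)⁻¹ * ((∫ z, K z * G (x - h * z)) - G x)) (𝓝[>] 0)
      (𝓝 (deriv (deriv G) x / 2 * kernelMoment K 2)) := by
  set R : ℝ → ℝ := fun y => (G (x + y) - G x - deriv G x * y) / y ^ 2 with hR
  obtain ⟨C, hC⟩ := hx.exists_taylor_bound hM
  have hRm : Measurable R := by
    have : Measurable fun y => G (x + y) := hG.comp (by fun_prop)
    fun_prop
  have hmain : Tendsto (fun h => ∫ z, z ^ 2 * K z * R (-h * z)) (𝓝[>] 0)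
      (𝓝 (deriv (deriv G) x / 2 * kernelMoment K 2)) := by
    rw [kernelMoment, ← integral_const_mul]
    refine tendsto_integral_filter_of_dominated_convergence (fun z => ‖z ^ 2 * K z‖ * C)
      (Eventually.of_forall fun h => ?_)
      (Eventually.of_forall fun h => ae_of_all _ fun z => ?_) (hK.integrable_two.norm.mul_const C) ?_
    · exact hK.integrable_two.1.mul (hRm.comp (by fun_prop)).aestronglyMeasurable
    · rw [norm_mul]
      gcongr
      exact hC _
    -- At `z = 0` the quotient is `0` by division by zero, whatever the second derivative; that
    -- point is null.
    · filter_upwards [compl_mem_ae_iff.2 (measure_singleton (0 : ℝ))] with z hz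
      have hz : z ≠ 0 := hz
      have h1 : Tendsto (fun h : ℝ => -h * z) (𝓝[>] 0) (𝓝[≠] 0) := by
        refine tendsto_nhdsWithin_iff.2 ⟨?_, ?_⟩
        · have : Continuous fun h : ℝ => -h * z := by fun_prop
          have := this.tendsto 0
          rw [neg_zero, zero_mul] at this
          exact this.mono_left nhdsWithin_le_nhds
        · filter_upwards [self_mem_nhdsWithin] with h hh
          exact mul_ne_zero (neg_ne_zero.2 (ne_of_gt hh)) hz
      rw [mul_comm (deriv (deriv G) x / 2)]
      exact (hx.tendsto_taylor.comp h1).const_mul _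
  refine hmain.congr' ?_
  filter_upwards [self_mem_nhdsWithin] with h hh
  have hh : h ≠ 0 := ne_of_gt hh
  have i1 := integrable_mul_comp_sub hK.integrable hG hM x h
  have i2 : Integrable fun z => G x * K z := hK.integrable.const_mul _
  have i3 : Integrable fun z => deriv G x * h * (z * K z) := hK.integrable_one.const_mul _
  have e : ∀ z, z ^ 2 * K z * R (-h * z) =
      (h ^ 2)⁻¹ * (K z * G (x - h * z) - G x * K z + deriv G x * h * (z * K z)) := by
    intro z
    rcases eq_or_ne z 0 with rfl | hz
    · simp [hR, mul_comm]
    · simp only [hR, ← sub_eq_add_neg, neg_mul]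
      field_simp
      ring
  simp_rw [e]
  rw [integral_const_mul, integral_add (f := fun z => _ - _) (i1.sub i2) i3, integral_sub i1 i2,
    integral_const_mul, integral_const_mul, hK.integral_eq_one, hK.integral_one]
  ring

theorem KernelAssumption.integrable_pow {K : ℝ → ℝ} (hK : KernelAssumption K) {j : ℕ} (hj : 1 ≤ j) :
    Integrable fun z => K z ^ j := by
  obtain ⟨M, hM⟩ := hK.bounded
  obtain ⟨i, rfl⟩ : ∃ i, j = i + 1 := ⟨j - 1, by omega⟩
  simp_rw [pow_succ']
  refine hK.integrable.mul_bdd (c := M ^ i) (hK.continuous.pow i).aestronglyMeasurable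
    (ae_of_all _ fun z => ?_)
  rw [norm_pow]
  gcongr
  exact hM z

/-! ### Moments of the innovations -/

/-- `∫ φ(t) g(s, t) dt`, as a function of `s`. -/
noncomputable def weightedMarginal (g : ℝ → ℝ → ℝ) (φ : ℝ → ℝ) (s : ℝ) : ℝ := ∫ t, φ t * g s t

theorem measurable_weightedMarginal {g : ℝ → ℝ → ℝ} (hg : Measurable (Function.uncurry g))
    {φ : ℝ → ℝ} (hφ : Measurable φ) : Measurable (weightedMarginal g φ) := by
  have : StronglyMeasurable (Function.uncurry fun s t => φ t * g s t) :=
    ((hφ.comp measurable_snd).mul hg).stronglyMeasurable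
  exact this.integral_prod_right.measurable

section

variable {Ω : Type*} [MeasurableSpace Ω] {P : Measure Ω} {X Y : ℕ → Ω → ℝ} {g : ℝ → ℝ → ℝ}

theorem IsSample.integrable_and_integral (H : IsSample P X Y g) {n : ℕ} (hn : 1 ≤ n)
    {k φ : ℝ → ℝ} (hk : Measurable k) (hki : Integrable k) (hφ : Measurable φ)
    (hi : ∀ s, Integrable fun t => φ t * g s t) {M : ℝ} (hM : ∀ s, ∫ t, |φ t| * g s t ≤ M) :
    Integrable (fun ω => k (X n ω) * φ (Y n ω)) P ∧
      ∫ ω, k (X n ω) * φ (Y n ω) ∂P = ∫ s, k s * weightedMarginal g φ s := by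
  have hgm := H.measurable_density
  have hXY : AEMeasurable (fun ω => (X n ω, Y n ω)) P :=
    ((H.measurable_X n hn).prodMk (H.measurable_Y n hn)).aemeasurable
  set Φ : ℝ × ℝ → ℝ := fun v => k v.1 * φ v.2 with hΦ
  have hΦm : Measurable Φ := (hk.comp measurable_fst).mul (hφ.comp measurable_snd)
  have hdm : Measurable fun v : ℝ × ℝ => ENNReal.ofReal (g v.1 v.2) := hgm.ennreal_ofReal
  have habs : ∀ s t, ‖k s * (φ t * g s t)‖ = |k s| * (|φ t| * g s t) := by
    intro s t
    rw [norm_mul, norm_mul, Real.norm_eq_abs, Real.norm_eq_abs,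
      Real.norm_of_nonneg (H.density_nonneg s t)]
  have hprod : Integrable (fun v : ℝ × ℝ => k v.1 * (φ v.2 * g v.1 v.2))
      ((volume : Measure ℝ).prod volume) := by
    have hm : Measurable fun v : ℝ × ℝ => k v.1 * (φ v.2 * g v.1 v.2) :=
      (hk.comp measurable_fst).mul ((hφ.comp measurable_snd).mul hgm)
    rw [integrable_prod_iff hm.aestronglyMeasurable]
    refine ⟨ae_of_all _ fun s => (hi s).const_mul (k s), ?_⟩
    refine (hki.norm.mul_const M).mono
      hm.norm.stronglyMeasurable.integral_prod_right'.aestronglyMeasurable (ae_of_all _ fun s => ?_)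
    simp_rw [habs]
    rw [integral_const_mul]
    have h0 : 0 ≤ ∫ t, |φ t| * g s t :=
      integral_nonneg fun t => mul_nonneg (abs_nonneg _) (H.density_nonneg s t)
    simp only [Real.norm_eq_abs, abs_mul, abs_abs]
    rw [abs_of_nonneg h0]
    exact mul_le_mul_of_nonneg_left ((hM s).trans (le_abs_self M)) (abs_nonneg _)
  have e : ∀ v : ℝ × ℝ, (ENNReal.ofReal (g v.1 v.2)).toReal • Φ v = k v.1 * (φ v.2 * g v.1 v.2) := by
    intro v
    rw [ENNReal.toReal_ofReal (H.density_nonneg _ _), smul_eq_mul]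
    simp only [hΦ]
    ring
  have hfin : ∀ᵐ v : ℝ × ℝ, ENNReal.ofReal (g v.1 v.2) < ⊤ :=
    ae_of_all _ fun _ => ENNReal.ofReal_lt_top
  constructor
  · have h1 : Integrable Φ (P.map fun ω => (X n ω, Y n ω)) := by
      rw [H.law n hn, integrable_withDensity_iff_integrable_smul' hdm hfin]
      simp_rw [e]
      exact hprod
    exact h1.comp_aemeasurable hXY
  · have h1 : ∫ ω, k (X n ω) * φ (Y n ω) ∂P = ∫ v, Φ v ∂(P.map fun ω => (X n ω, Y n ω)) :=
      (integral_map hXY hΦm.aestronglyMeasurable).symm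
    rw [h1, H.law n hn, integral_withDensity_eq_integral_toReal_smul hdm hfin]
    simp_rw [e]
    rw [Measure.volume_eq_prod, integral_prod _ hprod]
    simp_rw [integral_const_mul]
    rfl

/-- Moments of the form `E[φ(Y) k((x - X) / h)]`. -/
theorem IsSample.integrable_and_integral_kernel (H : IsSample P X Y g) {n : ℕ} (hn : 1 ≤ n)
    {k φ : ℝ → ℝ} (hk : Measurable k) (hki : Integrable k) (hφ : Measurable φ)
    (hi : ∀ s, Integrable fun t => φ t * g s t) {M : ℝ} (hM : ∀ s, ∫ t, |φ t| * g s t ≤ M)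
    {h : ℝ} (hh : 0 < h) (x : ℝ) :
    Integrable (fun ω => k (h⁻¹ * (x - X n ω)) * φ (Y n ω)) P ∧
      ∫ ω, k (h⁻¹ * (x - X n ω)) * φ (Y n ω) ∂P =
        h * ∫ z, k z * weightedMarginal g φ (x - h * z) := by
  have hki' : Integrable fun s => k (h⁻¹ * (x - s)) :=
    (hki.comp_mul_left' (inv_ne_zero hh.ne')).comp_sub_left x
  obtain ⟨h1, h2⟩ := H.integrable_and_integral hn (k := fun s => k (h⁻¹ * (x - s)))
    (hk.comp (by fun_prop)) hki' hφ hi hM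
  refine ⟨h1, h2.trans ?_⟩
  have e1 : ∫ s, k (h⁻¹ * (x - s)) * weightedMarginal g φ s =
      ∫ u, k (h⁻¹ * u) * weightedMarginal g φ (x - u) := by
    have := integral_sub_left_eq_self (μ := volume)
      (fun u => k (h⁻¹ * u) * weightedMarginal g φ (x - u)) x
    rw [← this]
    simp
  have e2 := Measure.integral_comp_mul_left
    (fun u => k (h⁻¹ * u) * weightedMarginal g φ (x - u)) h
  rw [e1]
  simp only [inv_mul_cancel_left₀ hh.ne', abs_of_pos (inv_pos.2 hh), smul_eq_mul] at e2
  rw [e2, mul_inv_cancel_left₀ hh.ne']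

end

theorem GS.tendsto_recSeq_div {m s q f c e : ℕ → ℝ} {μ ξ c₀ e₀ l : ℝ} (hm : GS m (-μ))
    (hl : 0 < l) (hsl : ∀ᶠ n : ℕ in atTop, l ≤ n * s n) (hs : Tendsto s atTop (𝓝 0))
    (hξ : Tendsto (fun n : ℕ => ((n : ℝ) * s n)⁻¹) atTop (𝓝 ξ))
    (hc : Tendsto c atTop (𝓝 c₀)) (hμ : μ * ξ < c₀) (he : Tendsto e atTop (𝓝 e₀))
    (hq : ∀ᶠ n in atTop, q n = 1 - s n * c n) (hf : ∀ᶠ n in atTop, f n = s n * m n * e n) :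
    Tendsto (fun n => recSeq q f n / m n) atTop (𝓝 (e₀ / (c₀ - μ * ξ))) := by
  refine hm.tendsto_div_of_recursion hl hsl hs hξ hc hμ he ?_
  filter_upwards [(tendsto_add_atTop_nat 1).eventually hq,
    (tendsto_add_atTop_nat 1).eventually hf] with n h1 h2
  rw [recSeq, h1, h2]

/-! ### The density assumption in terms of weighted marginals -/

section Density

variable {g : ℝ → ℝ → ℝ} {x : ℝ}

theorem DensityAssumption.abs_moment (hg : DensityAssumption g x) (h0 : ∀ s t, 0 ≤ g s t) {j : ℕ}
    (hj : j ≤ 3) : (∀ s, Integrable fun t => |t| ^ j * g s t) ∧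
      ∃ M, ∀ s, ∫ t, |t| ^ j * g s t ≤ M := by
  have heven : ∀ j ≤ 2, (∀ t : ℝ, |t| ^ j = t ^ j) → (∀ s, Integrable fun t => |t| ^ j * g s t) ∧
      ∃ M, ∀ s, ∫ t, |t| ^ j * g s t ≤ M := by
    intro j hj he
    simp_rw [he]
    obtain ⟨M, hM⟩ := hg.moment_bounded j hj
    exact ⟨hg.moment_integrable j hj, M, fun s => (le_abs_self _).trans (hM s)⟩
  obtain ⟨i0, M0, b0⟩ := heven 0 (by norm_num) (by simp)
  obtain ⟨i2, M2, b2⟩ := heven 2 le_rfl (by simp)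
  have hcase : j = 0 ∨ j = 1 ∨ j = 2 ∨ j = 3 := by omega
  rcases hcase with rfl | rfl | rfl | rfl
  · exact ⟨i0, M0, b0⟩
  -- Only the signed first moment is assumed bounded; the absolute one is controlled through `|t| ≤
  -- 1 + t²`.
  · have i1 : ∀ s, Integrable fun t => |t| ^ 1 * g s t := by
      intro s
      have := (hg.moment_integrable 1 (by norm_num) s).norm
      simpa [abs_of_nonneg (h0 _ _)] using this
    refine ⟨i1, M0 + M2, fun s => ?_⟩
    calc ∫ t, |t| ^ 1 * g s t ≤ ∫ t, (|t| ^ 0 * g s t + |t| ^ 2 * g s t) := by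
          refine integral_mono (i1 s) ((i0 s).add (i2 s)) fun t => ?_
          rw [← add_mul]
          refine mul_le_mul_of_nonneg_right ?_ (h0 s t)
          nlinarith [sq_nonneg (|t| - 1)]
      _ = (∫ t, |t| ^ 0 * g s t) + ∫ t, |t| ^ 2 * g s t := integral_add (i0 s) (i2 s)
      _ ≤ M0 + M2 := add_le_add (b0 s) (b2 s)
  · exact ⟨i2, M2, b2⟩
  · have h3 : (3 : ℝ) ∈ Set.Icc (2 : ℝ) 3 := by constructor <;> norm_num
    have e : ∀ t : ℝ, |t| ^ (3 : ℝ) = |t| ^ 3 := fun t => by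
      rw [← Real.rpow_natCast]
      norm_num
    have i3 := hg.abs_moment_integrable 3 h3
    obtain ⟨M, b3⟩ := hg.abs_moment_bounded 3 h3
    simp_rw [e] at i3 b3
    exact ⟨i3, M, b3⟩

theorem weightedMarginal_pow_zero (g : ℝ → ℝ → ℝ) :
    weightedMarginal g (fun t => t ^ 0) = marginal g := by
  ext s
  simp [weightedMarginal, marginal]

/-- Where the marginal vanishes, `aFun` is `0`, and nonnegativity forces `g s` to vanish almost
everywhere, so the integral is `0` as well. -/
theorem aFun_eq_weightedMarginal (hg : DensityAssumption g x) (h0 : ∀ s t, 0 ≤ g s t) :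
    aFun g = weightedMarginal g (fun t => t ^ 1) := by
  ext s
  rw [aFun, regFun, condMoment]
  by_cases hs : marginal g s = 0
  · have hi : Integrable fun t => g s t := by
      simpa using hg.moment_integrable 0 (by norm_num) s
    have h1 : (fun t => g s t) =ᵐ[volume] 0 := (integral_eq_zero_iff_of_nonneg (h0 s) hi).1 hs
    rw [hs, mul_zero, weightedMarginal]
    symm
    refine integral_eq_zero_of_ae ?_
    filter_upwards [h1] with t ht
    simp only [Pi.zero_apply] at ht
    simp [ht]
  · rw [div_mul_cancel₀ _ hs]
    rfl

end Density

/-! ### The innovations of the two recursive estimators -/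

section Innovations

variable {Ω : Type*} [MeasurableSpace Ω] {P : Measure Ω}
  {X Y : ℕ → Ω → ℝ} {g : ℝ → ℝ → ℝ} {K : ℝ → ℝ} {h : ℕ → ℝ} {x : ℝ}

/-- The innovation `h_n⁻¹ Y_n^q K((x - X_n) / h_n)` of `a_n` (`q = 1`) or of `f_n` (`q = 0`). -/
noncomputable def innov {Ω : Type*} (K : ℝ → ℝ) (h : ℕ → ℝ) (X Y : ℕ → Ω → ℝ) (x : ℝ) (q n : ℕ) (ω : Ω) : ℝ :=
  (h n)⁻¹ * (K ((h n)⁻¹ * (x - X n ω)) * Y n ω ^ q)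

theorem measurable_innov (H : IsSample P X Y g) (hK : KernelAssumption K) (q : ℕ) {n : ℕ}
    (hn : 1 ≤ n) : Measurable (innov K h X Y x q n) := by
  have h1 := H.measurable_X n hn
  have h2 := H.measurable_Y n hn
  have h3 := hK.continuous.measurable
  unfold innov
  fun_prop

theorem integral_innov (H : IsSample P X Y g) (hK : KernelAssumption K)
    (hg : DensityAssumption g x) {q n : ℕ} (hq : q ≤ 1) (hn : 1 ≤ n) (hh : 0 < h n) :
    ∫ ω, innov K h X Y x q n ω ∂P =
      ∫ z, K z * weightedMarginal g (fun t => t ^ q) (x - h n * z) := by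
  obtain ⟨M, hM⟩ := (hg.abs_moment H.density_nonneg (j := q) (by omega)).2
  simp_rw [← abs_pow] at hM
  have h1 := (H.integrable_and_integral_kernel hn hK.continuous.measurable hK.integrable
    (φ := fun t => t ^ q) (by fun_prop) (hg.moment_integrable q (by omega)) hM hh x).2
  simp only [innov]
  rw [integral_const_mul, h1, inv_mul_cancel_left₀ hh.ne']

theorem integral_innov_mul (H : IsSample P X Y g) (hK : KernelAssumption K)
    (hg : DensityAssumption g x) {q q' n : ℕ} (hq : q + q' ≤ 2) (hn : 1 ≤ n) (hh : 0 < h n) :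
    h n * ∫ ω, innov K h X Y x q n ω * innov K h X Y x q' n ω ∂P =
      ∫ z, K z ^ 2 * weightedMarginal g (fun t => t ^ (q + q')) (x - h n * z) := by
  obtain ⟨M, hM⟩ := (hg.abs_moment H.density_nonneg (j := q + q') (by omega)).2
  simp_rw [← abs_pow] at hM
  have h1 := (H.integrable_and_integral_kernel hn (hK.continuous.measurable.pow_const 2)
    (hK.integrable_pow one_le_two) (φ := fun t => t ^ (q + q')) (by fun_prop)
    (hg.moment_integrable _ hq) hM hh x).2
  have e : ∀ ω, innov K h X Y x q n ω * innov K h X Y x q' n ω =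
      (h n)⁻¹ * (h n)⁻¹ * (K ((h n)⁻¹ * (x - X n ω)) ^ 2 * Y n ω ^ (q + q')) := by
    intro ω
    simp only [innov, pow_add]
    ring
  simp_rw [e]
  rw [integral_const_mul, h1]
  field_simp

theorem integrable_and_exists_third_moment_innov (H : IsSample P X Y g) (hK : KernelAssumption K)
    (hg : DensityAssumption g x) {q : ℕ} (hq : q ≤ 1) :
    ∃ C, ∀ n, 1 ≤ n → 0 < h n → Integrable (fun ω => |innov K h X Y x q n ω| ^ 3) P ∧
      h n ^ 2 * ∫ ω, |innov K h X Y x q n ω| ^ 3 ∂P ≤ C := by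
  obtain ⟨hi, M, hM⟩ := hg.abs_moment H.density_nonneg (j := q * 3) (by omega)
  refine ⟨M * ∫ z, |K z| ^ 3, fun n hn hh => ?_⟩
  have hki : Integrable fun z => |K z| ^ 3 := by
    simpa using (hK.integrable_pow (j := 3) (by norm_num)).norm
  have hkm : Measurable fun z => |K z| ^ 3 := by
    have := hK.continuous.measurable
    fun_prop
  have hM' : ∀ s, ∫ t, |(|t| ^ (q * 3))| * g s t ≤ M := by simpa using hM
  obtain ⟨h1, h2⟩ := H.integrable_and_integral_kernel hn hkm hki
    (φ := fun t => |t| ^ (q * 3)) (by fun_prop) hi hM' hh x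
  have e : ∀ ω, |innov K h X Y x q n ω| ^ 3 =
      (h n)⁻¹ ^ 3 * (|K ((h n)⁻¹ * (x - X n ω))| ^ 3 * |Y n ω| ^ (q * 3)) := by
    intro ω
    rw [innov, abs_mul, abs_mul, abs_pow, mul_pow, mul_pow, ← pow_mul, abs_of_pos (inv_pos.2 hh)]
  simp_rw [e]
  refine ⟨h1.const_mul _, ?_⟩
  rw [integral_const_mul, h2]
  have e2 : ∀ c : ℝ, h n ^ 2 * ((h n)⁻¹ ^ 3 * (h n * c)) = c := by
    intro c
    field_simp
  rw [e2, ← integral_const_mul]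
  refine integral_mono_of_nonneg (ae_of_all _ fun z => ?_) (hki.const_mul M)
    (ae_of_all _ fun z => ?_)
  · exact mul_nonneg (by positivity)
      (integral_nonneg fun t => mul_nonneg (by positivity) (H.density_nonneg _ _))
  · simp only
    rw [mul_comm M]
    exact mul_le_mul_of_nonneg_left (hM _) (by positivity)

theorem measurable_estimators_past {Ω : Type*} (hK : KernelAssumption K) (stepβ stepγ : ℕ → ℝ)
    (X Y : ℕ → Ω → ℝ) (n : ℕ) :
    Measurable[⨆ i ∈ Set.Iio n, MeasurableSpace.comap (fun ω => (X (i + 1) ω, Y (i + 1) ω))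
      inferInstance] (fun ω => (aEst K stepβ h X Y x n ω, fEst K stepγ h X x n ω)) := by
  induction n with
  | zero => simp only [aEst, fEst]; exact measurable_const
  | succ n ih =>
    set 𝓕 : ℕ → MeasurableSpace Ω := fun n => ⨆ i ∈ Set.Iio n,
      MeasurableSpace.comap (fun ω => (X (i + 1) ω, Y (i + 1) ω)) inferInstance with h𝓕
    have hmono : 𝓕 n ≤ 𝓕 (n + 1) :=
      biSup_mono fun i hi => Set.mem_Iio.2 (lt_trans (Set.mem_Iio.1 hi) n.lt_succ_self)
    have hpair : Measurable[𝓕 (n + 1)] fun ω => (X (n + 1) ω, Y (n + 1) ω) :=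
      Measurable.mono (comap_measurable _)
        (le_biSup (fun i => MeasurableSpace.comap (fun ω => (X (i + 1) ω, Y (i + 1) ω))
          inferInstance) (Set.mem_Iio.2 n.lt_succ_self)) le_rfl
    have ih' : Measurable[𝓕 (n + 1)] fun ω =>
        (aEst K stepβ h X Y x n ω, fEst K stepγ h X x n ω) := ih.mono hmono le_rfl
    have hKm := hK.continuous.measurable
    have hψ : Measurable fun v : (ℝ × ℝ) × (ℝ × ℝ) =>
        ((1 - stepβ (n + 1)) * v.1.1 +
          stepβ (n + 1) * (h (n + 1))⁻¹ * v.2.2 * K ((h (n + 1))⁻¹ * (x - v.2.1)),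
        (1 - stepγ (n + 1)) * v.1.2 +
          stepγ (n + 1) * (h (n + 1))⁻¹ * K ((h (n + 1))⁻¹ * (x - v.2.1))) := by
      fun_prop
    exact hψ.fun_comp (Measurable.prodMk ih' hpair)

theorem past_le (H : IsSample P X Y g) (n : ℕ) :
    (⨆ i ∈ Set.Iio n, MeasurableSpace.comap (fun ω => (X (i + 1) ω, Y (i + 1) ω)) inferInstance) ≤
      (inferInstance : MeasurableSpace Ω) :=
  iSup₂_le fun i _ => ((H.measurable_X (i + 1) (by omega)).prodMk
    (H.measurable_Y (i + 1) (by omega))).comap_le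

theorem indepFun_estimators (H : IsSample P X Y g) (hK : KernelAssumption K)
    (stepβ stepγ : ℕ → ℝ) (n : ℕ) :
    IndepFun (fun ω => (aEst K stepβ h X Y x n ω, fEst K stepγ h X x n ω))
      (fun ω => (X (n + 1) ω, Y (n + 1) ω)) P := by
  have h1 := indep_iSup_of_disjoint (fun i => ((H.measurable_X (i + 1) (by omega)).prodMk
    (H.measurable_Y (i + 1) (by omega))).comap_le) H.indep
    (S := Set.Iio n) (T := {n}) (by simp)
  rw [IndepFun_iff_Indep]
  refine indep_of_indep_of_le_left (indep_of_indep_of_le_right h1 ?_)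
    (measurable_estimators_past hK stepβ stepγ X Y n).comap_le
  simp

theorem memLp_innov (H : IsSample P X Y g) (hK : KernelAssumption K) (hg : DensityAssumption g x)
    {q n : ℕ} (hq : q ≤ 1) (hn : 1 ≤ n) (hh : 0 < h n) : MemLp (innov K h X Y x q n) 3 P := by
  obtain ⟨C, hC⟩ := integrable_and_exists_third_moment_innov (h := h) H hK hg hq
  have hm := (measurable_innov (h := h) (x := x) H hK q hn).aestronglyMeasurable (μ := P)
  rw [← integrable_norm_rpow_iff hm (by norm_num) (by norm_num)]
  have := (hC n hn hh).1
  simpa using this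

theorem tendsto_integral_innov_bias (H : IsSample P X Y g) (hK : KernelAssumption K)
    (hg : DensityAssumption g x) {q : ℕ} (hq : q ≤ 1) (hpos : ∀ n, 1 ≤ n → 0 < h n)
    (hh : Tendsto h atTop (𝓝 0))
    (h2 : TwiceDifferentiableAt (weightedMarginal g fun t => t ^ q) x) :
    Tendsto (fun n => (h n ^ 2)⁻¹ * (∫ ω, innov K h X Y x q n ω ∂P -
        weightedMarginal g (fun t => t ^ q) x)) atTop
      (𝓝 (deriv (deriv (weightedMarginal g fun t => t ^ q)) x / 2 * kernelMoment K 2)) := by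
  obtain ⟨M, hM⟩ := hg.moment_bounded q (by omega)
  have hh' : Tendsto h atTop (𝓝[>] 0) := tendsto_nhdsWithin_iff.2
    ⟨hh, (eventually_ge_atTop 1).mono fun n hn => hpos n hn⟩
  refine ((hK.tendsto_bias (measurable_weightedMarginal H.measurable_density (by fun_prop))
    hM h2).comp hh').congr' ?_
  filter_upwards [eventually_ge_atTop 1] with n hn
  rw [integral_innov H hK hg hq hn (hpos n hn)]
  rfl

theorem tendsto_integral_innov (H : IsSample P X Y g) (hK : KernelAssumption K)
    (hg : DensityAssumption g x) {q : ℕ} (hq : q ≤ 1) (hpos : ∀ n, 1 ≤ n → 0 < h n)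
    (hh : Tendsto h atTop (𝓝 0)) :
    Tendsto (fun n => ∫ ω, innov K h X Y x q n ω ∂P) atTop
      (𝓝 (weightedMarginal g (fun t => t ^ q) x)) := by
  obtain ⟨M, hM⟩ := hg.moment_bounded q (by omega)
  have hh' : Tendsto h atTop (𝓝[>] 0) := tendsto_nhdsWithin_iff.2
    ⟨hh, (eventually_ge_atTop 1).mono fun n hn => hpos n hn⟩
  have h1 := (tendsto_integral_kernel hK.integrable
    (measurable_weightedMarginal H.measurable_density (φ := fun t => t ^ q) (by fun_prop))
    hM (hg.moment_continuousAt q (by omega))).comp hh'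
  rw [hK.integral_eq_one, mul_one] at h1
  refine h1.congr' ?_
  filter_upwards [eventually_ge_atTop 1] with n hn
  rw [integral_innov H hK hg hq hn (hpos n hn)]
  rfl

variable [IsProbabilityMeasure P]

/-- The centred innovations. -/
noncomputable def centeredInnov {Ω : Type*} [MeasurableSpace Ω] (P : Measure Ω) (K : ℝ → ℝ)
    (h : ℕ → ℝ) (X Y : ℕ → Ω → ℝ) (x : ℝ) (q n : ℕ) (ω : Ω) : ℝ :=
  innov K h X Y x q n ω - ∫ ω', innov K h X Y x q n ω' ∂P

theorem memLp_centeredInnov (H : IsSample P X Y g) (hK : KernelAssumption K)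
    (hg : DensityAssumption g x) {q n : ℕ} (hq : q ≤ 1) (hn : 1 ≤ n) (hh : 0 < h n) :
    MemLp (centeredInnov P K h X Y x q n) 3 P :=
  (memLp_innov H hK hg hq hn hh).sub (memLp_const _)

theorem integral_centeredInnov (H : IsSample P X Y g) (hK : KernelAssumption K)
    (hg : DensityAssumption g x) {q n : ℕ} (hq : q ≤ 1) (hn : 1 ≤ n) (hh : 0 < h n) :
    ∫ ω, centeredInnov P K h X Y x q n ω ∂P = 0 := by
  unfold centeredInnov
  rw [integral_sub ((memLp_innov H hK hg hq hn hh).integrable (by norm_num)) (integrable_const _)]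
  simp

theorem integral_centeredInnov_mul (H : IsSample P X Y g) (hK : KernelAssumption K)
    (hg : DensityAssumption g x) {q q' n : ℕ} (hq : q ≤ 1) (hq' : q' ≤ 1) (hn : 1 ≤ n)
    (hh : 0 < h n) :
    ∫ ω, centeredInnov P K h X Y x q n ω * centeredInnov P K h X Y x q' n ω ∂P =
      ∫ ω, innov K h X Y x q n ω * innov K h X Y x q' n ω ∂P -
        (∫ ω, innov K h X Y x q n ω ∂P) * ∫ ω, innov K h X Y x q' n ω ∂P := by
  have m1 := memLp_innov H hK hg hq hn hh
  have m2 := memLp_innov H hK hg hq' hn hh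
  have i1 : Integrable (fun ω => innov K h X Y x q n ω * innov K h X Y x q' n ω) P :=
    (m1.mono_exponent (p := 2) (by norm_num)).integrable_mul
      (m2.mono_exponent (p := 2) (by norm_num))
  set e := ∫ ω, innov K h X Y x q n ω ∂P with he
  set e' := ∫ ω, innov K h X Y x q' n ω ∂P with he'
  have i2 : Integrable (fun ω => e' * innov K h X Y x q n ω) P :=
    (m1.integrable (by norm_num)).const_mul _
  have i3 : Integrable (fun ω => e * innov K h X Y x q' n ω) P :=
    (m2.integrable (by norm_num)).const_mul _
  have e1 : ∀ ω, centeredInnov P K h X Y x q n ω * centeredInnov P K h X Y x q' n ω =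
      innov K h X Y x q n ω * innov K h X Y x q' n ω - e' * innov K h X Y x q n ω -
        e * innov K h X Y x q' n ω + e * e' := by
    intro ω
    simp only [centeredInnov, ← he, ← he']
    ring
  simp_rw [e1]
  rw [integral_add (f := fun ω => _ - _) ((i1.sub i2).sub i3) (integrable_const _),
    integral_sub (f := fun ω => _ - _) (i1.sub i2) i3, integral_sub i1 i2, integral_const_mul,
    integral_const_mul, ← he, ← he']
  simp
  ring

/-! ### Asymptotics of the moments of the centred innovations -/

/-- Second moments of the innovations are of order `1 / h_n` while their means stay bounded, so
centring does not affect the limit. -/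
theorem tendsto_integral_centeredInnov_mul (H : IsSample P X Y g) (hK : KernelAssumption K)
    (hg : DensityAssumption g x) {q q' : ℕ} (hq : q ≤ 1) (hq' : q' ≤ 1)
    (hpos : ∀ n, 1 ≤ n → 0 < h n) (hh : Tendsto h atTop (𝓝 0)) :
    Tendsto (fun n => h n *
        ∫ ω, centeredInnov P K h X Y x q n ω * centeredInnov P K h X Y x q' n ω ∂P) atTop
      (𝓝 (weightedMarginal g (fun t => t ^ (q + q')) x * kernelR K)) := by
  obtain ⟨M, hM⟩ := hg.moment_bounded (q + q') (by omega)
  have hh' : Tendsto h atTop (𝓝[>] 0) := tendsto_nhdsWithin_iff.2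
    ⟨hh, (eventually_ge_atTop 1).mono fun n hn => hpos n hn⟩
  have h1 := (tendsto_integral_kernel (hK.integrable_pow one_le_two)
    (measurable_weightedMarginal H.measurable_density (φ := fun t => t ^ (q + q')) (by fun_prop))
    hM (hg.moment_continuousAt (q + q') (by omega))).comp hh'
  have h3 := h1.sub (hh.mul ((tendsto_integral_innov H hK hg hq hpos hh).mul
    (tendsto_integral_innov H hK hg hq' hpos hh)))
  rw [zero_mul, sub_zero] at h3
  refine h3.congr' ?_
  filter_upwards [eventually_ge_atTop 1] with n hn
  rw [integral_centeredInnov_mul H hK hg hq hq' hn (hpos n hn), mul_sub,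
    integral_innov_mul H hK hg (by omega) hn (hpos n hn)]
  rfl

theorem exists_third_moment_centeredInnov_le (H : IsSample P X Y g) (hK : KernelAssumption K)
    (hg : DensityAssumption g x) {q : ℕ} (hq : q ≤ 1) (hpos : ∀ n, 1 ≤ n → 0 < h n)
    (hh : Tendsto h atTop (𝓝 0)) :
    ∃ C, ∀ᶠ n in atTop, h n ^ 2 * ∫ ω, |centeredInnov P K h X Y x q n ω| ^ 3 ∂P ≤ C := by
  obtain ⟨C, hC⟩ := integrable_and_exists_third_moment_innov (h := h) H hK hg hq
  have hlim := (hh.pow 2).mul ((tendsto_integral_innov H hK hg hq hpos hh).abs.pow 3)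
  rw [zero_pow two_ne_zero, zero_mul] at hlim
  refine ⟨4 * (C + 1), ?_⟩
  filter_upwards [eventually_ge_atTop 1, hlim.eventually_le_const one_pos] with n hn hn1
  obtain ⟨i1, b1⟩ := hC n hn (hpos n hn)
  set e := ∫ ω, innov K h X Y x q n ω ∂P with he
  have h1 : ∫ ω, |centeredInnov P K h X Y x q n ω| ^ 3 ∂P ≤
      4 * (∫ ω, |innov K h X Y x q n ω| ^ 3 ∂P + |e| ^ 3) := by
    have h2 : ∫ ω, 4 * (|innov K h X Y x q n ω| ^ 3 + |e| ^ 3) ∂P =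
        4 * (∫ ω, |innov K h X Y x q n ω| ^ 3 ∂P + |e| ^ 3) := by
      rw [integral_const_mul, integral_add i1 (integrable_const _)]
      simp
    rw [← h2]
    refine integral_mono (integrable_abs_pow_three
      (memLp_centeredInnov H hK hg hq hn (hpos n hn)))
      ((i1.add (integrable_const _)).const_mul 4) fun ω => ?_
    have := abs_add_pow_three_le (innov K h X Y x q n ω) (-e)
    rwa [abs_neg, ← sub_eq_add_neg] at this
  calc _ ≤ h n ^ 2 * (4 * (∫ ω, |innov K h X Y x q n ω| ^ 3 ∂P + |e| ^ 3)) := by gcongr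
    _ = 4 * (h n ^ 2 * ∫ ω, |innov K h X Y x q n ω| ^ 3 ∂P + h n ^ 2 * |e| ^ 3) := by ring
    _ ≤ _ := by linarith

/-! ### The centred estimators -/

/-- The mean of a recursive estimator with steps `p`. -/
noncomputable def meanSeq {Ω : Type*} [MeasurableSpace Ω] (P : Measure Ω) (K : ℝ → ℝ)
    (h : ℕ → ℝ) (X Y : ℕ → Ω → ℝ) (x : ℝ) (p : ℕ → ℝ) (q : ℕ) : ℕ → ℝ :=
  recSeq (fun n => 1 - p n) (fun n => p n * ∫ ω, innov K h X Y x q n ω ∂P)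

theorem centeredRecursion_estimators (H : IsSample P X Y g) (hK : KernelAssumption K)
    (hg : DensityAssumption g x) (hpos : ∀ n, 1 ≤ n → 0 < h n) (stepβ stepγ : ℕ → ℝ) :
    CenteredRecursion P stepβ stepγ
      (fun n ω => aEst K stepβ h X Y x n ω - meanSeq P K h X Y x stepβ 1 n)
      (fun n ω => fEst K stepγ h X x n ω - meanSeq P K h X Y x stepγ 0 n)
      (centeredInnov P K h X Y x 1) (centeredInnov P K h X Y x 0) where
  zero_fst ω := by simp [aEst, meanSeq, recSeq]
  zero_snd ω := by simp [fEst, meanSeq, recSeq]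
  succ_fst n ω := by
    simp only [aEst, meanSeq, recSeq, centeredInnov, innov]
    ring
  succ_snd n ω := by
    simp only [fEst, meanSeq, recSeq, centeredInnov, innov]
    ring
  measurable_fst n := (((measurable_estimators_past hK stepβ stepγ X Y n).mono
    (past_le H n) le_rfl).fst).sub_const _
  measurable_snd n := (((measurable_estimators_past hK stepβ stepγ X Y n).mono
    (past_le H n) le_rfl).snd).sub_const _
  memLp_fst n := memLp_centeredInnov H hK hg le_rfl (by omega) (hpos _ (by omega))
  memLp_snd n := memLp_centeredInnov H hK hg (by norm_num) (by omega) (hpos _ (by omega))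
  integral_fst n := integral_centeredInnov H hK hg le_rfl (by omega) (hpos _ (by omega))
  integral_snd n := integral_centeredInnov H hK hg (by norm_num) (by omega) (hpos _ (by omega))
  indep n := by
    have hKm := hK.continuous.measurable
    have h1 : Measurable fun v : ℝ × ℝ => (v.1 - meanSeq P K h X Y x stepβ 1 n,
        v.2 - meanSeq P K h X Y x stepγ 0 n) := by fun_prop
    have h2 : Measurable fun v : ℝ × ℝ =>
        ((h (n + 1))⁻¹ * (K ((h (n + 1))⁻¹ * (x - v.1)) * v.2 ^ 1) -
            ∫ ω', innov K h X Y x 1 (n + 1) ω' ∂P,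
          (h (n + 1))⁻¹ * (K ((h (n + 1))⁻¹ * (x - v.1)) * v.2 ^ 0) -
            ∫ ω', innov K h X Y x 0 (n + 1) ω' ∂P) := by fun_prop
    exact (indepFun_estimators H hK stepβ stepγ n).comp h1 h2

end Innovations

/-! ### Limit of the characteristic functions under varying weights -/

section

variable {Ω : Type*} [MeasurableSpace Ω] {P : Measure Ω} [IsProbabilityMeasure P]

theorem CenteredRecursion.tendsto_charFun {p q : ℕ → ℝ} {A F U W : ℕ → Ω → ℝ}
    (H : CenteredRecursion P p q A F U W) {s t δ : ℕ → ℝ} {v δ₀ : ℝ}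
    (hv : Tendsto (fun n => varForm P p q U W n (s n) (t n)) atTop (𝓝 v))
    (hA : Tendsto (fun n => |s n| ^ 3 * thirdSeq P p U n) atTop (𝓝 0))
    (hF : Tendsto (fun n => |t n| ^ 3 * thirdSeq P q W n) atTop (𝓝 0))
    (hδ : Tendsto δ atTop (𝓝 δ₀)) :
    Tendsto (fun n => ∫ ω, Complex.exp (((s n * A n ω + t n * F n ω + δ n : ℝ) : ℂ) *
        Complex.I) ∂P) atTop
      (𝓝 (Complex.exp ((δ₀ : ℂ) * Complex.I) * (Real.exp (-v / 2) : ℂ))) := by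
  have h1 : Tendsto (fun n => ∫ ω, Complex.exp (((s n * A n ω + t n * F n ω : ℝ) : ℂ) *
      Complex.I) ∂P - (Real.exp (-(varForm P p q U W n (s n) (t n)) / 2) : ℂ)) atTop (𝓝 0) := by
    refine squeeze_zero_norm (fun n => H.norm_charFun_sub_le n (s n) (t n)) ?_
    simpa using (hA.add hF).const_mul 24
  have h2 : Tendsto (fun n => (Real.exp (-(varForm P p q U W n (s n) (t n)) / 2) : ℂ)) atTop
      (𝓝 (Real.exp (-v / 2) : ℂ)) := by
    have hc : Continuous fun y : ℝ => (Real.exp (-y / 2) : ℂ) := by fun_prop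
    exact (hc.tendsto v).comp hv
  have h3 : Tendsto (fun n => Complex.exp ((δ n : ℂ) * Complex.I)) atTop
      (𝓝 (Complex.exp ((δ₀ : ℂ) * Complex.I))) := by
    have hc : Continuous fun y : ℝ => Complex.exp ((y : ℂ) * Complex.I) := by fun_prop
    exact (hc.tendsto δ₀).comp hδ
  have h4 := h3.mul (h1.add h2)
  rw [zero_add] at h4
  refine h4.congr fun n => ?_
  rw [sub_add_cancel, ← integral_const_mul]
  congr 1
  ext ω
  rw [← Complex.exp_add, ← add_mul, ← Complex.ofReal_add, add_comm (δ n)]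

end

/-! ### Normalised limit law of the regression estimator -/

theorem StepAssumption.tendsto_bandwidth_zero {stepβ h : ℕ → ℝ} {β a : ℝ}
    (hstep : StepAssumption stepβ h β a) : Tendsto h atTop (𝓝 0) :=
  hstep.gs_bandwidth.tendsto_zero (by linarith [hstep.a_mem.1])

theorem StepAssumption.tendsto_step_zero {stepβ h : ℕ → ℝ} {β a : ℝ}
    (hstep : StepAssumption stepβ h β a) : Tendsto stepβ atTop (𝓝 0) :=
  hstep.gs_step.tendsto_zero (by linarith [hstep.β_mem.1])

/-- Asymptotics of the two estimators relative to a normalising sequence `m ∈ GS(-μ)` with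
`β_n h_n⁻¹ / m_n² → lam` and `h_n² / m_n → θ`. -/
theorem tendstoInDistribution_rEst {Ω : Type*} [MeasurableSpace Ω] (P : Measure Ω)
    [IsProbabilityMeasure P] {X Y : ℕ → Ω → ℝ} {g : ℝ → ℝ → ℝ} (H : IsSample P X Y g)
    {K : ℝ → ℝ} (hK : KernelAssumption K) {stepγ stepβ h : ℕ → ℝ} {β a : ℝ}
    (hstep : StepAssumption stepβ h β a)
    (hγ : ∀ n : ℕ, 1 ≤ n → stepγ n = (1 - a) * (n : ℝ)⁻¹)
    {ξ : ℝ} (hξ : Tendsto (fun n : ℕ => ((n : ℝ) * stepβ n)⁻¹) atTop (𝓝 ξ))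
    {x : ℝ} (hg : DensityAssumption g x) (hfx : 0 < marginal g x)
    (hf2 : TwiceDifferentiableAt (marginal g) x) (ha2 : TwiceDifferentiableAt (aFun g) x)
    {m : ℕ → ℝ} {μ lam θ l : ℝ} (hm : GS m (-μ)) (hm0 : Tendsto m atTop (𝓝 0))
    (hlam : Tendsto (fun n => stepβ n * (h n)⁻¹ / m n ^ 2) atTop (𝓝 lam))
    (hθ : Tendsto (fun n => h n ^ 2 / m n) atTop (𝓝 θ))
    (hl : 0 < l) (hsl : ∀ᶠ n : ℕ in atTop, l ≤ n * stepβ n)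
    (hμξ : μ * ξ < 1) (hμa : μ < 1 - a) :
    ∃ v B : ℝ, 0 ≤ v ∧
      v = (lam * (condMoment g 2 x * marginal g x * kernelR K) / (2 - 2 * μ * ξ) -
        2 * regFun g x * ((1 - a) * ξ * lam * (aFun g x * kernelR K) /
          (1 + (1 - a) * ξ - 2 * μ * ξ)) +
        regFun g x ^ 2 * ((1 - a) ^ 2 * ξ * lam * (marginal g x * kernelR K) /
          (2 * (1 - a) - 2 * μ))) / marginal g x ^ 2 ∧
      B = (θ * (deriv (deriv (aFun g)) x / 2 * kernelMoment K 2) / (1 - μ * ξ) -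
        regFun g x * ((1 - a) * (θ * (deriv (deriv (marginal g)) x / 2 * kernelMoment K 2)) /
          (1 - a - μ))) / marginal g x ∧
      TendstoInDistribution
        (fun (n : ℕ) (ω : Ω) => (m n)⁻¹ * (rEst K stepγ stepβ h X Y x n ω - regFun g x))
        atTop (id : ℝ → ℝ) (fun _ => P) (gaussianReal B v.toNNReal) := by
  have hh0 := hstep.tendsto_bandwidth_zero
  have hhpos := hstep.gs_bandwidth.1
  have hβ0 := hstep.tendsto_step_zero
  have hβpos := hstep.gs_step.1
  have ha1 : 0 < 1 - a := by linarith [hstep.a_mem.2]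
  have hξ0 : 0 ≤ ξ := ge_of_tendsto hξ (by
    filter_upwards [eventually_ge_atTop 1] with n hn
    exact inv_nonneg.2 (mul_nonneg n.cast_nonneg (hβpos n hn).le))
  have hmpos := hm.1
  have hm2 : GS (fun n => m n ^ 2) (-(2 * μ)) := by
    have := hm.pow 2
    rwa [Nat.cast_ofNat, mul_neg] at this
  have hm3 : GS (fun n => m n ^ 3) (-(3 * μ)) := by
    have := hm.pow 3
    rwa [Nat.cast_ofNat, mul_neg] at this
  have haw := aFun_eq_weightedMarginal hg H.density_nonneg
  have hfw := weightedMarginal_pow_zero g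
  -- the harmonic step
  have hinv0 : Tendsto (fun n : ℕ => (n : ℝ)⁻¹) atTop (𝓝 0) := tendsto_inv_atTop_nhds_zero_nat
  have hinv1 : ∀ᶠ n : ℕ in atTop, (1 : ℝ) ≤ n * (n : ℝ)⁻¹ := by
    filter_upwards [eventually_ge_atTop 1] with n hn
    rw [mul_inv_cancel₀ (by positivity)]
  have hinvξ : Tendsto (fun n : ℕ => ((n : ℝ) * (n : ℝ)⁻¹)⁻¹) atTop (𝓝 1) := by
    refine tendsto_const_nhds.congr' ?_
    filter_upwards [eventually_ge_atTop 1] with n hn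
    rw [mul_inv_cancel₀ (by positivity), inv_one]
  -- moments of the innovations
  have bias1 := tendsto_integral_innov_bias (q := 1) H hK hg le_rfl hhpos hh0 (by rwa [← haw])
  have bias0 := tendsto_integral_innov_bias (q := 0) H hK hg zero_le_one hhpos hh0
    (by rwa [hfw])
  rw [← haw] at bias1
  rw [hfw] at bias0
  have cov11 := tendsto_integral_centeredInnov_mul (q := 1) (q' := 1) H hK hg le_rfl le_rfl hhpos hh0
  have cov10 := tendsto_integral_centeredInnov_mul (q := 1) (q' := 0) H hK hg le_rfl zero_le_one
    hhpos hh0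
  have cov00 := tendsto_integral_centeredInnov_mul (q := 0) (q' := 0) H hK hg zero_le_one zero_le_one
    hhpos hh0
  simp only [Nat.reduceAdd, add_zero] at cov11 cov10 cov00
  rw [← haw] at cov10
  rw [hfw] at cov00
  obtain ⟨C1, hC1⟩ := exists_third_moment_centeredInnov_le (q := 1) H hK hg le_rfl hhpos hh0
  obtain ⟨C0, hC0⟩ := exists_third_moment_centeredInnov_le (q := 0) H hK hg zero_le_one hhpos hh0
  set U := centeredInnov P K h X Y x 1 with hU
  set W := centeredInnov P K h X Y x 0 with hW
  set G₂ := weightedMarginal g (fun t => t ^ 2) x with hG₂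
  set f := marginal g x with hf
  set r := regFun g x with hr
  have har : aFun g x = r * f := rfl
  have hG₂f : condMoment g 2 x * f = G₂ := div_mul_cancel₀ _ hfx.ne'
  rw [hG₂f]
  -- means
  have mean1 : Tendsto (fun n => (meanSeq P K h X Y x stepβ 1 n - aFun g x) / m n) atTop
      (𝓝 (θ * (deriv (deriv (aFun g)) x / 2 * kernelMoment K 2) / (1 - μ * ξ))) := by
    refine hm.tendsto_div_of_recursion (c := fun _ => 1) (e := fun n =>
      h n ^ 2 / m n * ((h n ^ 2)⁻¹ * (∫ ω, innov K h X Y x 1 n ω ∂P - aFun g x))) hl hsl hβ0 hξ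
      tendsto_const_nhds hμξ (hθ.mul bias1) (Eventually.of_forall fun n => ?_)
    have h1 := (hhpos (n + 1) (by omega)).ne'
    have h2 := (hmpos (n + 1) (by omega)).ne'
    simp only [meanSeq, recSeq]
    field_simp
    ring
  -- The recursion for `f_n` is run with step `1 / n` and damping `1 - a`; for this step the role of
  -- `ξ` is played by `1`, so the condition becomes `μ < 1 - a`.
  have mean0 : Tendsto (fun n => (meanSeq P K h X Y x stepγ 0 n - f) / m n) atTop
      (𝓝 ((1 - a) * (θ * (deriv (deriv (marginal g)) x / 2 * kernelMoment K 2)) /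
        (1 - a - μ))) := by
    have := hm.tendsto_div_of_recursion (u := fun n => meanSeq P K h X Y x stepγ 0 n - f)
      (c := fun _ => 1 - a) (e := fun n => (1 - a) * (h n ^ 2 / m n * ((h n ^ 2)⁻¹ *
        (∫ ω, innov K h X Y x 0 n ω ∂P - f)))) one_pos hinv1 hinv0 hinvξ
      tendsto_const_nhds (by linarith) ((hθ.mul bias0).const_mul (1 - a))
      (Eventually.of_forall fun n => ?_)
    · simpa using this
    · have h1 := (hhpos (n + 1) (by omega)).ne'
      have h2 := (hmpos (n + 1) (by omega)).ne'
      have h3 : ((n + 1 : ℕ) : ℝ) ≠ 0 := by positivity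
      simp only [meanSeq, recSeq]
      rw [hγ (n + 1) (by omega)]
      field_simp
      ring
  -- variances and covariance
  have varA : Tendsto (fun n => covSeq P stepβ stepβ U U n / m n ^ 2) atTop
      (𝓝 (lam * (G₂ * kernelR K) / (2 - 2 * μ * ξ))) := by
    refine hm2.tendsto_recSeq_div (c := fun n => 2 - stepβ n)
      (e := fun n => stepβ n * (h n)⁻¹ / m n ^ 2 * (h n * ∫ ω, U n ω * U n ω ∂P)) hl hsl hβ0 hξ
      (by simpa using hβ0.const_sub 2) (by linarith) (hlam.mul cov11)
      (Eventually.of_forall fun n => by ring) ?_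
    filter_upwards [eventually_ge_atTop 1] with n hn
    have h1 := (hhpos n hn).ne'
    have h2 := (hmpos n hn).ne'
    field_simp
  -- Here `β_n` is the step and `γ_n = (1 - a) (n β_n)⁻¹ β_n`. The condition `2μξ < 1 + (1 - a)ξ`
  -- combines `μξ < 1` with `μ < 1 - a` and `ξ ≥ 0`.
  have covAF : Tendsto (fun n => covSeq P stepβ stepγ U W n / m n ^ 2) atTop
      (𝓝 ((1 - a) * ξ * lam * (aFun g x * kernelR K) / (1 + (1 - a) * ξ - 2 * μ * ξ))) := by
    refine hm2.tendsto_recSeq_div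
      (c := fun n => 1 + (1 - a) * ((n : ℝ) * stepβ n)⁻¹ - (1 - a) * (n : ℝ)⁻¹)
      (e := fun n => (1 - a) * ((n : ℝ) * stepβ n)⁻¹ * (stepβ n * (h n)⁻¹ / m n ^ 2) *
        (h n * ∫ ω, U n ω * W n ω ∂P)) hl hsl hβ0 hξ
      (by simpa using ((hξ.const_mul (1 - a)).const_add 1).sub (hinv0.const_mul (1 - a)))
      (by nlinarith) (((hξ.const_mul (1 - a)).mul hlam).mul cov10) ?_ ?_
    · filter_upwards [eventually_ge_atTop 1] with n hn
      have h1 := (hβpos n hn).ne'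
      have h3 : (n : ℝ) ≠ 0 := by positivity
      rw [hγ n hn]
      field_simp
      ring
    · filter_upwards [eventually_ge_atTop 1] with n hn
      have h0 := (hβpos n hn).ne'
      have h1 := (hhpos n hn).ne'
      have h2 := (hmpos n hn).ne'
      have h3 : (n : ℝ) ≠ 0 := by positivity
      rw [hγ n hn]
      field_simp
  have varF : Tendsto (fun n => covSeq P stepγ stepγ W W n / m n ^ 2) atTop
      (𝓝 ((1 - a) ^ 2 * ξ * lam * (f * kernelR K) / (2 * (1 - a) - 2 * μ))) := by
    have := hm2.tendsto_recSeq_div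
      (q := fun n => (1 - stepγ n) * (1 - stepγ n))
      (f := fun n => stepγ n * stepγ n * ∫ ω, W n ω * W n ω ∂P)
      (c := fun n : ℕ => 2 * (1 - a) - (1 - a) ^ 2 * (n : ℝ)⁻¹) (c₀ := 2 * (1 - a))
      (e := fun n => (1 - a) ^ 2 * ((n : ℝ) * stepβ n)⁻¹ * (stepβ n * (h n)⁻¹ / m n ^ 2) *
        (h n * ∫ ω, W n ω * W n ω ∂P)) one_pos hinv1 hinv0 hinvξ
      (by simpa using (hinv0.const_mul ((1 - a) ^ 2)).const_sub (2 * (1 - a)))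
      (by linarith) (((hξ.const_mul ((1 - a) ^ 2)).mul hlam).mul cov00) ?_ ?_
    · simpa using! this
    · filter_upwards [eventually_ge_atTop 1] with n hn
      rw [hγ n hn]
      ring
    · filter_upwards [eventually_ge_atTop 1] with n hn
      have h0 := (hβpos n hn).ne'
      have h1 := (hhpos n hn).ne'
      have h2 := (hmpos n hn).ne'
      have h3 : (n : ℝ) ≠ 0 := by positivity
      rw [hγ n hn]
      field_simp
  -- third moments
  have third_aux : ∀ (V : ℕ → Ω → ℝ) (C : ℝ),
      (∀ᶠ n in atTop, h n ^ 2 * ∫ ω, |V n ω| ^ 3 ∂P ≤ C) →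
      Tendsto (fun n => (stepβ n * (h n)⁻¹ / m n ^ 2) ^ 2 * m n * (h n ^ 2 * ∫ ω, |V n ω| ^ 3 ∂P))
        atTop (𝓝 0) := by
    intro V C hV
    have h1 : Tendsto (fun n => (stepβ n * (h n)⁻¹ / m n ^ 2) ^ 2 * m n) atTop (𝓝 0) := by
      simpa using (hlam.pow 2).mul hm0
    refine h1.zero_mul_isBoundedUnder_le (isBoundedUnder_of_eventually_le (a := C) ?_)
    filter_upwards [hV] with n hn
    rw [Function.comp_apply, Real.norm_of_nonneg]
    · exact hn
    · exact mul_nonneg (sq_nonneg _) (integral_nonneg fun ω => by positivity)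
  -- Third moments of the innovations are `O(h_n⁻²)`, and `β_n² h_n⁻² = m_n³ · (β_n h_n⁻¹ / m_n²)²
  -- m_n`; the spare factor `m_n` makes the forcing negligible.
  have thirdA : Tendsto (fun n => thirdSeq P stepβ U n / m n ^ 3) atTop (𝓝 0) := by
    have := hm3.tendsto_recSeq_div (q := fun n => |1 - stepβ n| ^ 3)
      (f := fun n => |stepβ n| ^ 3 * ∫ ω, |U n ω| ^ 3 ∂P)
      (c := fun n => 3 - 3 * stepβ n + stepβ n ^ 2) (c₀ := 3)
      (e := fun n => (stepβ n * (h n)⁻¹ / m n ^ 2) ^ 2 * m n *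
        (h n ^ 2 * ∫ ω, |U n ω| ^ 3 ∂P)) hl hsl hβ0 hξ
      (by simpa using ((hβ0.const_mul 3).const_sub 3).add (hβ0.pow 2)) (by linarith)
      (third_aux U C1 hC1) ?_ ?_
    · rwa [zero_div] at this
    · filter_upwards [hβ0.eventually_le_const one_pos] with n hn
      rw [abs_of_nonneg (by linarith)]
      ring
    · filter_upwards [eventually_ge_atTop 1] with n hn
      have h0 := (hβpos n hn).ne'
      have h1 := (hhpos n hn).ne'
      have h2 := (hmpos n hn).ne'
      rw [abs_of_pos (hβpos n hn)]
      field_simp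
  have thirdF : Tendsto (fun n => thirdSeq P stepγ W n / m n ^ 3) atTop (𝓝 0) := by
    have he := ((hξ.pow 2).const_mul ((1 - a) ^ 3)).mul (third_aux W C0 hC0)
    rw [mul_zero] at he
    have := hm3.tendsto_recSeq_div (q := fun n => |1 - stepγ n| ^ 3)
      (f := fun n => |stepγ n| ^ 3 * ∫ ω, |W n ω| ^ 3 ∂P)
      (c := fun n : ℕ => (1 - a) * (3 - 3 * ((1 - a) * (n : ℝ)⁻¹) + ((1 - a) * (n : ℝ)⁻¹) ^ 2))
      (c₀ := (1 - a) * 3) one_pos hinv1 hinv0 hinvξ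
      (by simpa using ((((hinv0.const_mul (1 - a)).const_mul 3).const_sub 3).add
        ((hinv0.const_mul (1 - a)).pow 2)).const_mul (1 - a)) (by linarith) he ?_ ?_
    · rwa [zero_div] at this
    · filter_upwards [eventually_ge_atTop 1,
        (hinv0.const_mul (1 - a)).eventually_le_const (by rw [mul_zero]; exact one_pos)] with n hn hn1
      rw [hγ n hn, abs_of_nonneg (by linarith)]
      ring
    · filter_upwards [eventually_ge_atTop 1] with n hn
      have h0 := (hβpos n hn).ne'
      have h1 := (hhpos n hn).ne'
      have h2 := (hmpos n hn).ne'
      have h3 : (0 : ℝ) < n := by positivity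
      rw [hγ n hn, abs_of_pos (by positivity)]
      field_simp
  -- convergence in distribution
  have HC := centeredRecursion_estimators H hK hg hhpos stepβ stepγ
  have hmeasA : ∀ n, Measurable fun ω => aEst K stepβ h X Y x n ω := fun n =>
    ((measurable_estimators_past hK stepβ stepγ X Y n).mono (past_le H n) le_rfl).fst
  have hmeasF : ∀ n, Measurable fun ω => fEst K stepγ h X x n ω := fun n =>
    ((measurable_estimators_past hK stepβ stepγ X Y n).mono (past_le H n) le_rfl).snd
  set vA := lam * (G₂ * kernelR K) / (2 - 2 * μ * ξ) with hvA
  set vAF := (1 - a) * ξ * lam * (aFun g x * kernelR K) / (1 + (1 - a) * ξ - 2 * μ * ξ) with hvAF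
  set vF := (1 - a) ^ 2 * ξ * lam * (f * kernelR K) / (2 * (1 - a) - 2 * μ) with hvF
  set B1 := θ * (deriv (deriv (aFun g)) x / 2 * kernelMoment K 2) / (1 - μ * ξ) with hB1
  set B0 := (1 - a) * (θ * (deriv (deriv (marginal g)) x / 2 * kernelMoment K 2)) / (1 - a - μ)
    with hB0
  set v₀ := vA - 2 * r * vAF + r ^ 2 * vF with hv₀
  have hvar : ∀ τ : ℝ, Tendsto (fun n => varForm P stepβ stepγ U W n (τ * (m n)⁻¹)
      (-(τ * r) * (m n)⁻¹)) atTop (𝓝 (τ ^ 2 * v₀)) := by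
    intro τ
    have := (((varA.sub (covAF.const_mul (2 * r))).add (varF.const_mul (r ^ 2)))).const_mul (τ ^ 2)
    refine this.congr fun n => ?_
    simp only [varForm]
    ring
  have hv₀nn : 0 ≤ v₀ := by
    have := ge_of_tendsto' (hvar 1) fun n => HC.varForm_nonneg n _ _
    linarith
  have hscale : ∀ (T : ℕ → ℝ) (κ : ℝ), Tendsto (fun n => T n / m n ^ 3) atTop (𝓝 0) →
      Tendsto (fun n => |κ * (m n)⁻¹| ^ 3 * T n) atTop (𝓝 0) := by
    intro T κ hT
    have := hT.const_mul (|κ| ^ 3)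
    rw [mul_zero] at this
    refine this.congr' ?_
    filter_upwards [eventually_ge_atTop 1] with n hn
    rw [abs_mul, abs_of_pos (inv_pos.2 (hmpos n hn))]
    ring
  have hnum : TendstoInDistribution (fun n ω => (m n)⁻¹ * (aEst K stepβ h X Y x n ω -
      r * fEst K stepγ h X x n ω)) atTop (id : ℝ → ℝ) (fun _ => P)
      (gaussianReal (B1 - r * B0) v₀.toNNReal) := by
    refine tendstoInDistribution_gaussianReal (fun n =>
      (((hmeasA n).sub ((hmeasF n).const_mul r)).const_mul _).aemeasurable) hv₀nn fun τ => ?_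
    -- The centring constants cancel because `a(x) = r(x) f(x)`.
    have hδ := (mean1.sub (mean0.const_mul r)).const_mul τ
    refine (HC.tendsto_charFun (hvar τ) (hscale _ τ thirdA) (hscale _ (-(τ * r)) thirdF) hδ).congr
      fun n => ?_
    congr 1
    ext ω
    congr 3
    simp only [har, Pi.sub_apply]
    ring
  have hden : TendstoInMeasure P (fun n ω => fEst K stepγ h X x n ω) atTop (fun _ => f) := by
    refine tendstoInMeasure_of_tendstoInDistribution_const ?_
    rw [← Real.toNNReal_zero]
    -- Consistency of `f_n` is the same argument with weights `0` and `τ`, unscaled, so that the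
    -- variance vanishes in the limit.
    refine tendstoInDistribution_gaussianReal (fun n => (hmeasF n).aemeasurable) le_rfl fun τ => ?_
    have hm_ne : ∀ᶠ n in atTop, m n ≠ 0 :=
      (eventually_ge_atTop 1).mono fun n hn => (hmpos n hn).ne'
    have hmean : Tendsto (fun n => τ * meanSeq P K h X Y x stepγ 0 n) atTop (𝓝 (τ * f)) := by
      refine Tendsto.const_mul τ ?_
      have := (mean0.mul hm0).add_const f
      rw [mul_zero, zero_add] at this
      refine this.congr' (hm_ne.mono fun n hn => ?_)
      field_simp
      ring
    have hvarF : Tendsto (fun n => varForm P stepβ stepγ U W n 0 τ) atTop (𝓝 (τ ^ 2 * 0)) := by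
      have := ((varF.mul (hm0.pow 2)).const_mul (τ ^ 2))
      rw [zero_pow two_ne_zero, mul_zero] at this
      refine this.congr' (hm_ne.mono fun n hn => ?_)
      simp only [varForm]
      field_simp
      ring
    have hthird : Tendsto (fun n => |τ| ^ 3 * thirdSeq P stepγ W n) atTop (𝓝 0) := by
      have := ((thirdF.mul (hm0.pow 3)).const_mul (|τ| ^ 3))
      rw [zero_mul, mul_zero] at this
      refine this.congr' (hm_ne.mono fun n hn => ?_)
      field_simp
    refine (HC.tendsto_charFun (s := fun _ => 0) (t := fun _ => τ) hvarF (by simp) hthird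
      hmean).congr fun n => ?_
    congr 1
    ext ω
    congr 3
    ring
  refine ⟨_, _, ?_, rfl, rfl, ?_⟩
  · exact div_nonneg hv₀nn (sq_nonneg f)
  · have hfin := tendstoInDistribution_ratio (fun n => (hmeasA n).aemeasurable)
      (fun n => (hmeasF n).aemeasurable) hfx hnum hden
    refine hfin.congr (fun n => ae_of_all _ fun ω => ?_) (ae_of_all _ fun _ => rfl)
    simp only [rEst]
    split_ifs with h0
    · rfl
    · rw [not_not.1 h0, div_zero]

/-! ### Relations between the exponents and the stepsize limit -/

theorem GS_natCast : GS (fun n : ℕ => (n : ℝ)) 1 := by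
  refine ⟨fun n hn => Nat.cast_pos.2 hn, tendsto_const_nhds.congr' ?_⟩
  filter_upwards [eventually_ge_atTop 1] with n hn
  have : (n : ℝ) ≠ 0 := by positivity
  rw [Nat.cast_sub hn]
  field_simp
  simp

/-- If `β < 1`, then `n β_n ∈ GS(1 - β)` diverges and `ξ = 0`. -/
theorem StepAssumption.mul_limit_eq_zero {stepβ h : ℕ → ℝ} {β a ξ : ℝ}
    (hstep : StepAssumption stepβ h β a)
    (hξ : Tendsto (fun n : ℕ => ((n : ℝ) * stepβ n)⁻¹) atTop (𝓝 ξ)) : (1 - β) * ξ = 0 := by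
  rcases hstep.β_mem.2.lt_or_eq with hβ | hβ
  · have h1 := (GS_natCast.mul hstep.gs_step).tendsto_atTop (by linarith)
    rw [tendsto_nhds_unique hξ h1.inv_tendsto_atTop, mul_zero]
  · rw [hβ, sub_self, zero_mul]

/-- Any real `l` strictly between `κ` and the possibly infinite limit of `n β_n` works: then `ξ ≤ 1
/ l`, whence `κ ξ < 1`. -/
theorem StepAssumption.exists_lower_bound {stepβ h : ℕ → ℝ} {β a ξ κ : ℝ}
    (hstep : StepAssumption stepβ h β a)
    (hξ : Tendsto (fun n : ℕ => ((n : ℝ) * stepβ n)⁻¹) atTop (𝓝 ξ))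
    (hκ : 0 ≤ κ) (hmin : min (2 * a) ((β - a) / 2) = κ) :
    ∃ l : ℝ, 0 < l ∧ (∀ᶠ n : ℕ in atTop, l ≤ n * stepβ n) ∧ κ * ξ < 1 := by
  obtain ⟨L, hL, hlt⟩ := hstep.lim_step
  rw [hmin] at hlt
  obtain ⟨l, h1, h2⟩ := EReal.lt_iff_exists_real_btwn.1 hlt
  have hκl : κ < l := EReal.coe_lt_coe_iff.1 h1
  have hl : 0 < l := hκ.trans_lt hκl
  have hev : ∀ᶠ n : ℕ in atTop, l ≤ n * stepβ n := by
    filter_upwards [hL.eventually_const_lt h2] with n hn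
    exact (EReal.coe_lt_coe_iff.1 hn).le
  have hξl : ξ ≤ l⁻¹ := le_of_tendsto hξ (hev.mono fun n hn => inv_anti₀ hl hn)
  refine ⟨l, hl, hev, ?_⟩
  calc κ * ξ ≤ κ * l⁻¹ := by gcongr
    _ < 1 := by rwa [← div_eq_mul_inv, div_lt_one hl]

theorem GS.nonpos_of_tendsto {v : ℕ → ℝ} {γ c : ℝ} (hv : GS v γ) (hc : Tendsto v atTop (𝓝 c)) :
    γ ≤ 0 := by
  by_contra hγ
  exact not_tendsto_nhds_of_tendsto_atTop (hv.tendsto_atTop (not_le.1 hγ)) c hc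

theorem GS.nonneg_of_tendsto_pos {v : ℕ → ℝ} {γ c : ℝ} (hv : GS v γ) (hc : Tendsto v atTop (𝓝 c))
    (hc0 : c ≠ 0) : 0 ≤ γ := by
  by_contra hγ
  exact hc0 (tendsto_nhds_unique hc (hv.tendsto_zero (not_le.1 hγ)))

theorem GS.nonneg_of_tendsto_atTop {v : ℕ → ℝ} {γ : ℝ} (hv : GS v γ) (hc : Tendsto v atTop atTop) :
    0 ≤ γ := by
  by_contra hγ
  exact not_tendsto_nhds_of_tendsto_atTop hc 0 (hv.tendsto_zero (not_le.1 hγ))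

theorem StepAssumption.gs_bias_ratio {stepβ h : ℕ → ℝ} {β a : ℝ}
    (hstep : StepAssumption stepβ h β a) : GS (fun n => (stepβ n)⁻¹ * h n ^ 5) (β - 5 * a) := by
  have := hstep.gs_step.inv.mul (hstep.gs_bandwidth.pow 5)
  convert this using 1
  push_cast
  ring

end SemiRecursive

/-! ### The two bandwidth regimes -/

theorem theorem2 {Ω : Type*} [MeasurableSpace Ω] (P : Measure Ω) [IsProbabilityMeasure P]
    (X Y : ℕ → Ω → ℝ) (g : ℝ → ℝ → ℝ) (hXY : SemiRecursive.IsSample P X Y g)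
    (K : ℝ → ℝ) (hK : SemiRecursive.KernelAssumption K)
    (stepγ stepβ h : ℕ → ℝ) (β a : ℝ) (hstep : SemiRecursive.StepAssumption stepβ h β a)
    (hγ : ∀ n : ℕ, 1 ≤ n → stepγ n = (1 - a) * (n : ℝ)⁻¹)
    (ξ : ℝ) (hξ : Tendsto (fun n : ℕ => ((n : ℝ) * stepβ n)⁻¹) atTop (𝓝 ξ))
    (x : ℝ) (hg : SemiRecursive.DensityAssumption g x)
    (hfx : 0 < SemiRecursive.marginal g x)
    (hf2 : SemiRecursive.TwiceDifferentiableAt (SemiRecursive.marginal g) x)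
    (ha2 : SemiRecursive.TwiceDifferentiableAt (SemiRecursive.aFun g) x) :
    (∀ c : ℝ, 0 ≤ c →
      Tendsto (fun n : ℕ => (stepβ n)⁻¹ * h n ^ 5) atTop (𝓝 c) →
      Tendsto (fun n : ℕ => stepβ n * (h n)⁻¹) atTop (𝓝 0) →
      0 ≤ SemiRecursive.varV K g a ξ β x ∧
      TendstoInDistribution
        (fun (n : ℕ) (ω : Ω) => √((stepβ n)⁻¹ * h n) *
          (SemiRecursive.rEst K stepγ stepβ h X Y x n ω - SemiRecursive.regFun g x))
        atTop (id : ℝ → ℝ) (fun _ => P)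
        (gaussianReal (√c * SemiRecursive.biasB K g a ξ x)
          (SemiRecursive.varV K g a ξ β x).toNNReal)) ∧
    (Tendsto (fun n : ℕ => (stepβ n)⁻¹ * h n ^ 5) atTop atTop →
      TendstoInMeasure P
        (fun (n : ℕ) (ω : Ω) => (h n ^ 2)⁻¹ *
          (SemiRecursive.rEst K stepγ stepβ h X Y x n ω - SemiRecursive.regFun g x))
        atTop (fun _ => SemiRecursive.biasB K g a ξ x)) := by
  have hβ1 := hstep.β_mem.1
  have hβ2 := hstep.β_mem.2
  have ha0 := hstep.a_mem.1
  have ha1 := hstep.a_mem.2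
  have hβpos := hstep.gs_step.1
  have hhpos := hstep.gs_bandwidth.1
  have hξβ := hstep.mul_limit_eq_zero hξ
  have haf : SemiRecursive.aFun g x = SemiRecursive.regFun g x * SemiRecursive.marginal g x := rfl
  constructor
  · intro c hc hc5 hβh
    have hgs : SemiRecursive.GS (fun n => stepβ n * (h n)⁻¹) (-(β - a)) := by
      have := hstep.gs_step.mul hstep.gs_bandwidth.inv
      convert this using 1
      ring
    have hm : SemiRecursive.GS (fun n => √(stepβ n * (h n)⁻¹)) (-((β - a) / 2)) := by
      rw [← neg_div]
      exact hgs.sqrt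
    -- This inequality says `(β - a) / 2 ≤ 2a`, so the minimum in (A2) is the exponent of the
    -- normalisation.
    have h5a : β - 5 * a ≤ 0 := hstep.gs_bias_ratio.nonpos_of_tendsto hc5
    have hβa : 0 ≤ β - a := by linarith [hgs.nonpos_of_tendsto hβh]
    obtain ⟨l, hl, hsl, hμξ⟩ := hstep.exists_lower_bound (κ := (β - a) / 2) hξ (by linarith)
      (min_eq_right (by linarith))
    have hm0 : Tendsto (fun n => √(stepβ n * (h n)⁻¹)) atTop (𝓝 0) := by
      simpa using hβh.sqrt
    have hlam : Tendsto (fun n => stepβ n * (h n)⁻¹ / √(stepβ n * (h n)⁻¹) ^ 2) atTop (𝓝 1) := by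
      refine tendsto_const_nhds.congr' ?_
      filter_upwards [eventually_ge_atTop 1] with n hn
      rw [Real.sq_sqrt (hgs.1 n hn).le, div_self (hgs.1 n hn).ne']
    have hθ : Tendsto (fun n => h n ^ 2 / √(stepβ n * (h n)⁻¹)) atTop (𝓝 √c) := by
      refine hc5.sqrt.congr' ?_
      filter_upwards [eventually_ge_atTop 1] with n hn
      have h1 := hβpos n hn
      have h2 := hhpos n hn
      rw [← Real.sqrt_sq (by positivity : 0 ≤ h n ^ 2), ← Real.sqrt_div (by positivity)]
      congr 1
      field_simp
    obtain ⟨v, B, hv0, hv, hB, hlim⟩ := SemiRecursive.tendstoInDistribution_rEst P hXY hK hstep hγ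
      hξ hg hfx hf2 ha2 hm hm0 hlam hθ hl hsl hμξ (by linarith)
    have hvV : v = SemiRecursive.varV K g a ξ β x := by
      -- By `(1 - β) ξ = 0`, the covariance and density variance terms lose their denominators, and
      -- `-2 + 1` leaves the single correction `-(1 - a) ξ r² / f`.
      have e1 : 1 + (1 - a) * ξ - 2 * ((β - a) / 2) * ξ = 1 := by linear_combination hξβ
      have e2 : (1 - a) ^ 2 * ξ * 1 * (SemiRecursive.marginal g x * SemiRecursive.kernelR K) /
          (2 * (1 - a) - 2 * ((β - a) / 2)) =
          (1 - a) * ξ * (SemiRecursive.marginal g x * SemiRecursive.kernelR K) := by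
        rw [div_eq_iff (by linarith)]
        linear_combination -(1 - a) * (SemiRecursive.marginal g x * SemiRecursive.kernelR K) * hξβ
      rw [hv, e1, e2, haf, SemiRecursive.varV]
      have e3 : 2 - 2 * ((β - a) / 2) * ξ ≠ 0 := by linarith
      have e4 : 2 - (β - a) * ξ ≠ 0 := by linarith
      rw [show 2 - 2 * ((β - a) / 2) * ξ = 2 - (β - a) * ξ by ring]
      field_simp
      ring
    have hBB : B = √c * SemiRecursive.biasB K g a ξ x := by
      -- For `c = 0` both sides vanish, even if a denominator in `biasB` is zero. For `c > 0` the
      -- ratio has a positive limit, which forces `β = 5a` and `(β - a) / 2 = 2a`.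
      rcases hc.eq_or_lt with rfl | hcpos
      · rw [hB]
        simp
      · have h5 : β = 5 * a :=
          le_antisymm (by linarith)
            (by linarith [hstep.gs_bias_ratio.nonneg_of_tendsto_pos hc5 hcpos.ne'])
        have e0 : (β - a) / 2 = 2 * a := by rw [h5]; ring
        rw [hB, SemiRecursive.biasB]
        rw [e0] at hμξ ⊢
        have e1 : 1 - 2 * a * ξ ≠ 0 := by linarith
        have e2 : 1 - 3 * a ≠ 0 := by linarith
        rw [show 1 - a - 2 * a = 1 - 3 * a by ring]
        field_simp
    rw [← hvV, ← hBB]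
    refine ⟨hv0, ?_⟩
    have hsq : ∀ n, (√(stepβ n * (h n)⁻¹))⁻¹ = √((stepβ n)⁻¹ * h n) := fun n => by
      rw [← Real.sqrt_inv, mul_inv, inv_inv]
    simp_rw [hsq] at hlim
    exact hlim
  · intro hc5
    have h5a : 0 ≤ β - 5 * a := hstep.gs_bias_ratio.nonneg_of_tendsto_atTop hc5
    obtain ⟨l, hl, hsl, hμξ⟩ := hstep.exists_lower_bound (κ := 2 * a) hξ (by linarith)
      (min_eq_left (by linarith))
    have hm : SemiRecursive.GS (fun n => h n ^ 2) (-(2 * a)) := by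
      have := hstep.gs_bandwidth.pow 2
      rwa [Nat.cast_ofNat, mul_neg] at this
    have hm0 : Tendsto (fun n => h n ^ 2) atTop (𝓝 0) := by
      simpa using hstep.tendsto_bandwidth_zero.pow 2
    -- This ratio is the inverse of `β_n⁻¹ h_n⁵`: the variance is negligible against the squared
    -- bias.
    have hlam : Tendsto (fun n => stepβ n * (h n)⁻¹ / (h n ^ 2) ^ 2) atTop (𝓝 0) := by
      refine hc5.inv_tendsto_atTop.congr' ?_
      filter_upwards [eventually_ge_atTop 1] with n hn
      have h1 := (hβpos n hn).ne'
      have h2 := (hhpos n hn).ne'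
      rw [Pi.inv_apply]
      field_simp
    have hθ : Tendsto (fun n => h n ^ 2 / h n ^ 2) atTop (𝓝 1) := by
      refine tendsto_const_nhds.congr' ?_
      filter_upwards [eventually_ge_atTop 1] with n hn
      rw [div_self (hm.1 n hn).ne']
    obtain ⟨v, B, hv0, hv, hB, hlim⟩ := SemiRecursive.tendstoInDistribution_rEst P hXY hK hstep hγ
      hξ hg hfx hf2 ha2 hm hm0 hlam hθ hl hsl hμξ (by linarith)
    have hBB : B = SemiRecursive.biasB K g a ξ x := by
      have e1 : 1 - 2 * a * ξ ≠ 0 := by linarith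
      -- Here `5a ≤ β ≤ 1`, so `a ≤ 1/5`.
      have e2 : 1 - 3 * a ≠ 0 := by linarith
      rw [hB, SemiRecursive.biasB, show 1 - a - 2 * a = 1 - 3 * a by ring]
      field_simp
    have hv' : v = 0 := by
      rw [hv]
      simp
    rw [hBB, hv', Real.toNNReal_zero] at hlim
    exact SemiRecursive.tendstoInMeasure_of_tendstoInDistribution_const hlim
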